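/- For a mapping $f:[n]\to[n]$, and for a rooted labelled tree $T$ with vertex set $[n]$ whose edges are directed towards the root (the root has no outgoing edge), regard the nodes as parking spaces and the directed edges ($i\to f(i)$ in the case of a mapping) as one-way streets. Let $s=(s_1,\dots,s_m)\in[n]^m$. Drivers $1,\dots,m$ arrive one after the other; driver $k$ starts at node $s_k$, follows the directed edges and parks at the first free node that he meets, if there is one. If all $m$ drivers are able to park, then $s$ is called a parking function for $f$ (respectively for $T$). Let $M_{n,m}$ be the number of pairs $(f,s)$ where $f:[n]\to[n]$ and $s\in[n]^m$ is a parking function for $f$, and let $F_{n,m}$ be the number of pairs $(T,s)$ where $T$ is a rooted unordered labelled tree with vertex set $[n]$ and $s\in[n]^m$ is a parking function for $T$. Then, for all integers $n\ge 1$ and $0\le m\le n$, $$M_{n,m}=\frac{(n-1)!\,m!\,n^{n-m}}{(n-m)!}\sum_{j=0}^{m}\binom{2m-n-j}{m-j}\frac{(2n)^j(n-j)}{j!}$$ and $$F_{n,m}=\frac{(n-1)!\,m!\,n^{n-m-1}}{(n-m)!}\sum_{j=0}^{m}\binom{2m-n-j}{m-j}\frac{(2n)^j(n-j)}{j!},$$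 that is, $F_{n,m}=M_{n,m}/n$. Here $\binom{x}{k}=\frac{x(x-1)\cdots(x-k+1)}{k!}$ for every (possibly negative) integer $x$ and every integer $k\ge 0$. -/

import Mathlib

/-! Parking in a finite road net in which every node has at most one outgoing street. -/

namespace Parking

/-- The node reached from `v` after `k` steps along the streets; `next u = none` means that no
street leaves `u`, so a car driving on from `u` leaves the road net. -/
def visit {V : Type*} (next : V → Option V) (v : V) : ℕ → Option V
  | 0 => some v
  | k + 1 => (visit next v k).bind next

/-- A driver with preferred node `v`, arriving when the nodes of `occupied` are taken, parks at
`w`: the node `w` is the first free node met when starting in `v` and following the streets. -/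
def ParksAt {V : Type*} (next : V → Option V) (occupied : Set V) (v w : V) : Prop :=
  ∃ k : ℕ, visit next v k = some w ∧ w ∉ occupied ∧
    ∀ i < k, ∀ u : V, visit next v i = some u → u ∈ occupied

/-- `s` is a parking function: the drivers `0, 1, …, m - 1` arrive in this order, and all of them
manage to park, driver `k` at the node `π k`. -/
def IsParkingFunction {V : Type*} (next : V → Option V) {m : ℕ} (s : Fin m → V) : Prop :=
  ∃ π : Fin m → V, ∀ k : Fin m, ParksAt next {v | ∃ i : Fin m, i < k ∧ π i = v} (s k) (π k)

/-- `s` is a parking function for the mapping `f`, i.e. for its functional digraph. -/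
def IsMappingParkingFunction {n m : ℕ} (f : Fin n → Fin n) (s : Fin m → Fin n) : Prop :=
  IsParkingFunction (fun v => some (f v)) s

/-- A rooted unordered labelled tree of size `n` (Cayley tree), with label set `Fin n`. -/
@[ext]
structure RootedTree (n : ℕ) where
  /-- the underlying unrooted labelled tree -/
  graph : SimpleGraph (Fin n)
  isTree : graph.IsTree
  root : Fin n

/-- The unique path from `v` to the root. -/
noncomputable def RootedTree.pathToRoot {n : ℕ} (T : RootedTree n) (v : Fin n) :
    T.graph.Walk v T.root :=
  (T.isTree.existsUnique_path v T.root).choose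

/-- Edges are directed towards the root: the street from a non-root node `v` leads to the second
node of the path from `v` to the root; no street leaves the root. -/
noncomputable def RootedTree.parent {n : ℕ} (T : RootedTree n) (v : Fin n) : Option (Fin n) :=
  if v = T.root then none else some (T.pathToRoot v).snd

/-- `s` is a parking function for the tree `T`. -/
def IsTreeParkingFunction {n m : ℕ} (T : RootedTree n) (s : Fin m → Fin n) : Prop :=
  IsParkingFunction T.parent s

/-- The number `M_{n,m}` of `(n,m)`-mapping parking functions `(f, s)`. -/
noncomputable def numMapping (n m : ℕ) : ℕ :=
  Nat.card {p : (Fin n → Fin n) × (Fin m → Fin n) // IsMappingParkingFunction p.1 p.2}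

instance (n : ℕ) : Finite (RootedTree n) :=
  Finite.of_injective (fun T : RootedTree n => (T.graph, T.root))
    (fun _ _ h => RootedTree.ext (congrArg Prod.fst h) (congrArg Prod.snd h))

/-- The number `F_{n,m}` of `(n,m)`-tree parking functions `(T, s)`. -/
noncomputable def numTree (n m : ℕ) : ℕ :=
  Nat.card {p : RootedTree n × (Fin m → Fin n) // IsTreeParkingFunction p.1 p.2}

end Parking

/-! The pairs (road net, preferences) are counted by revealing the net lazily. A state consists of
the occupied set `O` and the forest `g` of streets used so far, all inside `O`. A driver who meets
an occupied node runs to the root `r` of its tree, and only then is the street out of `r` revealed.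
It leads back into the same tree (the driver circles forever, contribution 0), into another tree
(the two merge and the driver goes on), or to a free node (he parks, and everything traversed
becomes one tree). The number of choices depends only on the tree sizes, so the count depends only
on the partition of `O` into trees (`sum_extCount`, `stateWeight`). After the last driver, the
number of completions depends only on the number k of roots: n^k for mappings
(`extCount_mappingFamily`) and n^(k-1) for rooted trees (`extCount_treeFamily`). This is the source
of the factor 1/n.

Running the process backwards, a tree of b occupied nodes receives the weight (b-1)! C_{b-1} with
Catalan numbers C. The invariance in `sum_parts_stateWeight_succ` rests on the Catalan recurrence
(`clusterWeight_rec`). The sum over set partitions is then an exponential formula (`sum_parts_pow`):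
its generating function z satisfies z(0) = 1 and z' = n C(x) z.

With W = x C(x), so that W = x + W^2 and C = 1/(1-W), this integrates to z = exp(2nW) (1-W)^n
(`derivative_forestSeries`). The coefficients follow from [x^k] C^p W' = binom(2k+p, k) for all
integers p (`coeff_catUnit_zpow_mul_derivative`), which gives the stated sum (`coeff_forestSeries`).
-/

set_option linter.unusedSectionVars false

open Finset

namespace Parking

/-! ### Partial functions as rooted forests, and attaching a root to another tree. -/

section Forest

variable {V : Type*}

/-- `Leads g v r`: following the partial function `g` from `v` ends in `r`, where `g` is
undefined. -/
inductive Leads (g : V → Option V) : V → V → Prop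
  | root {r : V} : g r = none → Leads g r r
  | step {v w r : V} : g v = some w → Leads g w r → Leads g v r

theorem Leads.target {g : V → Option V} {v r : V} (h : Leads g v r) : g r = none := by
  induction h with
  | root h => exact h
  | step _ _ ih => exact ih

theorem Leads.unique {g : V → Option V} {v r r' : V} (h : Leads g v r) (h' : Leads g v r') :
    r = r' := by
  induction h with
  | root h =>
    cases h' with
    | root _ => rfl
    | step h2 _ => simp [h] at h2
  | step h1 _ ih =>
    cases h' with
    | root h2 => simp [h1] at h2
    | step h2 h3 =>
      rw [h1] at h2
      cases h2
      exact ih h3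

/-- Every node leads to a root: the partial function `g` is a forest of rooted trees. -/
def IsForest (g : V → Option V) : Prop := ∀ v, ∃ r, Leads g v r

/-- The partial function `F` extends the partial function `g`. -/
def Extends (F g : V → Option V) : Prop := ∀ v w, g v = some w → F v = some w

variable [DecidableEq V]

theorem Leads.update_of_ne {g : V → Option V} {r x v z : V} (h : Leads g v z) (hz : z ≠ r)
    (hr : g r = none) : Leads (Function.update g r (some x)) v z := by
  induction h with
  | root h => exact .root (by rwa [Function.update_of_ne hz])
  | @step v w z h1 _ ih =>
    refine .step (w := w) ?_ (ih hz)
    rwa [Function.update_of_ne]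
    rintro rfl
    simp [hr] at h1

theorem Leads.update_trans {g : V → Option V} {r x y v : V} (h : Leads g v r)
    (hx : Leads g x y) (hy : y ≠ r) : Leads (Function.update g r (some x)) v y := by
  have hr := h.target
  induction h with
  | root h => exact .step (Function.update_self ..) (hx.update_of_ne hy h)
  | @step v w z h1 _ ih =>
    refine .step (w := w) ?_ (ih hy hr)
    rwa [Function.update_of_ne]
    rintro rfl
    simp [hr] at h1

theorem IsForest.update {g : V → Option V} (hg : IsForest g) {r x y : V} (hr : g r = none)
    (hx : Leads g x y) (hy : y ≠ r) : IsForest (Function.update g r (some x)) := by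
  intro v
  obtain ⟨z, hz⟩ := hg v
  by_cases h : z = r
  · subst h
    exact ⟨y, hz.update_trans hx hy⟩
  · exact ⟨z, hz.update_of_ne h hr⟩

/-- The condition `y ≠ r` says that `x` lies outside the tree of `r`; the new street then merges the
tree of `r` into that of `y` without closing a cycle. -/
theorem leads_update_iff {g : V → Option V} (hg : IsForest g) {r x y : V} (hr : g r = none)
    (hx : Leads g x y) (hy : y ≠ r) (v z : V) :
    Leads (Function.update g r (some x)) v z ↔
      (Leads g v r ∧ z = y) ∨ (z ≠ r ∧ Leads g v z) := by
  constructor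
  · intro h
    obtain ⟨t, ht⟩ := hg v
    by_cases htr : t = r
    · subst htr
      exact Or.inl ⟨ht, h.unique (ht.update_trans hx hy)⟩
    · have := h.unique (ht.update_of_ne htr hr)
      subst this
      exact Or.inr ⟨htr, ht⟩
  · rintro (⟨h, rfl⟩ | ⟨h, h'⟩)
    · exact h.update_trans hx hy
    · exact h'.update_of_ne h hr

theorem extends_update_iff {F g : V → Option V} {r x : V} (hr : g r = none) :
    Extends F (Function.update g r (some x)) ↔ Extends F g ∧ F r = some x := by
  constructor
  · intro h
    refine ⟨fun v w hv => h v w ?_, h r x (Function.update_self ..)⟩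
    rwa [Function.update_of_ne]
    rintro rfl
    simp [hr] at hv
  · rintro ⟨h, h'⟩ v w hv
    by_cases hvr : v = r
    · subst hvr
      simp only [Function.update_self, Option.some.injEq] at hv
      rw [← hv, h']
    · rw [Function.update_of_ne hvr] at hv
      exact h v w hv

end Forest

/-! ### An inductive description of driving and parking. -/

section Driving

variable {V : Type*}

/-- A driver starting in `v` reaches the first free node `w`. -/
inductive Drives (F : V → Option V) (O : Set V) : V → V → Prop
  | park {v : V} : v ∉ O → Drives F O v v
  | drive {v u w : V} : v ∈ O → F v = some u → Drives F O u w → Drives F O v w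

theorem visit_succ (F : V → Option V) (v : V) (k : ℕ) :
    visit F v (k + 1) = (F v).bind fun u => visit F u k := by
  induction k with
  | zero => cases h : F v <;> simp [visit, h]
  | succ k ih =>
    rw [visit, ih]
    cases h : F v <;> simp [visit]

/-- The inductive form allows a driver to be moved forward one street at a time, which the
step-counting definition does not show directly. -/
theorem parksAt_iff_drives {F : V → Option V} {O : Set V} {v w : V} :
    ParksAt F O v w ↔ Drives F O v w := by
  constructor
  · rintro ⟨k, hk, hw, h⟩
    induction k generalizing v with
    | zero =>
      cases hk
      exact .park hw
    | succ k ih =>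
      rw [visit_succ] at hk
      obtain ⟨u, hu, hk⟩ := Option.bind_eq_some_iff.1 hk
      refine .drive (h 0 (Nat.succ_pos _) v rfl) hu (ih hk fun i hi t ht => ?_)
      refine h (i + 1) (Nat.succ_lt_succ hi) t ?_
      rw [visit_succ, hu]
      exact ht
  · intro h
    induction h with
    | park h => exact ⟨0, rfl, h, fun i hi => absurd hi (Nat.not_lt_zero _)⟩
    | drive h1 h2 _ ih =>
      obtain ⟨k, hk, hw, h⟩ := ih
      refine ⟨k + 1, by rw [visit_succ, h2]; exact hk, hw, fun i hi t ht => ?_⟩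
      cases i with
      | zero =>
        cases ht
        exact h1
      | succ i =>
        rw [visit_succ, h2] at ht
        exact h i (Nat.lt_of_succ_lt_succ hi) t ht

theorem Drives.unique {F : V → Option V} {O : Set V} {v w w' : V} (h : Drives F O v w)
    (h' : Drives F O v w') : w = w' := by
  induction h with
  | park h =>
    cases h' with
    | park _ => rfl
    | drive h2 => exact absurd h2 h
  | drive h1 h2 _ ih =>
    cases h' with
    | park h3 => exact absurd h1 h3
    | drive h3 h4 h5 =>
      rw [h2] at h4
      cases h4
      exact ih h5

theorem drives_iff_of_not_mem {F : V → Option V} {O : Set V} {v w : V} (hv : v ∉ O) :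
    Drives F O v w ↔ w = v := by
  constructor
  · intro h
    exact h.unique (.park hv)
  · rintro rfl
    exact .park hv

theorem drives_iff_of_mem {F : V → Option V} {O : Set V} {v w u : V} (hv : v ∈ O)
    (hu : F v = some u) : Drives F O v w ↔ Drives F O u w := by
  constructor
  · intro h
    cases h with
    | park h => exact absurd hv h
    | drive _ h2 h3 =>
      rw [hu] at h2
      cases h2
      exact h3
  · exact .drive hv hu

theorem not_drives_of_none {F : V → Option V} {O : Set V} {v w : V} (hv : v ∈ O)
    (hu : F v = none) : ¬ Drives F O v w := by
  intro h
  cases h with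
  | park h => exact h hv
  | drive _ h2 _ => simp [hu] at h2

theorem not_drives_of_closed {F : V → Option V} {O K : Set V} (hK : K ⊆ O)
    (hF : ∀ v ∈ K, ∀ u, F v = some u → u ∈ K) {v w : V} (hv : v ∈ K) : ¬ Drives F O v w := by
  intro h
  induction h with
  | park h => exact h (hK hv)
  | drive _ h2 _ ih => exact ih (hF _ hv _ h2)

variable [DecidableEq V]

/-- The drivers with the preferences listed in `l`, arriving in this order when the nodes of `O` are
taken, all find a parking space. -/
def AllPark (F : V → Option V) : Finset V → List V → Prop
  | _, [] => True
  | O, v :: l => ∃ w, Drives F (O : Set V) v w ∧ AllPark F (insert w O) l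

/-- An arbitrary initial set `O` is needed for the induction: after the first driver parks, his node
joins `O` for the remaining ones. -/
theorem allPark_ofFn_iff {F : V → Option V} {m : ℕ} (O : Finset V) (s : Fin m → V) :
    AllPark F O (List.ofFn s) ↔ ∃ π : Fin m → V, ∀ k : Fin m,
      Drives F {v | v ∈ O ∨ ∃ i : Fin m, i < k ∧ π i = v} (s k) (π k) := by
  induction m generalizing O with
  | zero => simp [AllPark]
  | succ m ih =>
    rw [List.ofFn_succ, AllPark]
    have key : ∀ (w : V) (π : Fin m → V) (k : Fin m),
        {v | v ∈ insert w O ∨ ∃ i : Fin m, i < k ∧ π i = v} =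
          {v | v ∈ O ∨ ∃ i : Fin (m + 1), i < k.succ ∧
            (Fin.cons w π : Fin (m + 1) → V) i = v} := by
      intro w π k
      ext v
      simp only [Finset.mem_insert, Set.mem_ofPred_eq, Fin.exists_fin_succ, Fin.cons_zero,
        Fin.cons_succ, Fin.succ_lt_succ_iff, Fin.succ_pos, true_and]
      constructor
      · rintro ((rfl | h) | h)
        exacts [Or.inr (Or.inl rfl), Or.inl h, Or.inr (Or.inr h)]
      · rintro (h | rfl | h)
        exacts [Or.inl (Or.inr h), Or.inl (Or.inl rfl), Or.inr h]
    constructor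
    · rintro ⟨w, hw, h⟩
      obtain ⟨π, hπ⟩ := (ih _ _).1 h
      refine ⟨Fin.cons w π, fun k => ?_⟩
      refine Fin.cases ?_ (fun k => ?_) k
      · simpa using hw
      · rw [← key]
        exact hπ k
    · rintro ⟨π, hπ⟩
      refine ⟨π 0, by simpa using hπ 0, (ih _ _).2 ⟨fun k => π k.succ, fun k => ?_⟩⟩
      rw [key, show (Fin.cons (π 0) fun k : Fin m => π k.succ : Fin (m + 1) → V) = π from
        Fin.cons_self_tail π]
      exact hπ k.succ

theorem isParkingFunction_iff_allPark {F : V → Option V} {m : ℕ} (s : Fin m → V) :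
    IsParkingFunction F s ↔ AllPark F ∅ (List.ofFn s) := by
  rw [allPark_ofFn_iff]
  simp [IsParkingFunction, parksAt_iff_drives]

theorem allPark_cons_of_not_mem {F : V → Option V} {O : Finset V} {v : V} (hv : v ∉ O)
    (l : List V) : AllPark F O (v :: l) ↔ AllPark F (insert v O) l := by
  simp [AllPark, drives_iff_of_not_mem (show v ∉ (O : Set V) from hv)]

theorem allPark_cons_of_mem {F : V → Option V} {O : Finset V} {v u : V} (hv : v ∈ O)
    (hu : F v = some u) (l : List V) : AllPark F O (v :: l) ↔ AllPark F O (u :: l) := by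
  simp [AllPark, drives_iff_of_mem (show v ∈ (O : Set V) from hv) hu]

end Driving

/-! ### Counting road nets while their streets are revealed. -/

section Count

variable {V : Type*} [Fintype V] [DecidableEq V]

open Classical in
/-- The number of road nets in `Fam` extending `g` in which the drivers with preferences `l` can
all park when the nodes of `O` are taken. -/
noncomputable def extCount (Fam : Finset (V → Option V)) (g : V → Option V) (O : Finset V)
    (l : List V) : ℕ :=
  (Fam.filter fun F => Extends F g ∧ AllPark F O l).card

open Classical in
/-- The tree with root `r` of the forest `g`. -/
noncomputable def comp (g : V → Option V) (r : V) : Finset V := univ.filter fun v => Leads g v r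

theorem mem_comp {g : V → Option V} {r v : V} : v ∈ comp g r ↔ Leads g v r := by
  simp [comp]

/-- The roots of the forest `g` among the nodes of `O`. -/
def rootsIn (g : V → Option V) (O : Finset V) : Finset V := O.filter fun v => g v = none

theorem mem_rootsIn {g : V → Option V} {O : Finset V} {r : V} :
    r ∈ rootsIn g O ↔ r ∈ O ∧ g r = none := by
  simp [rootsIn]

/-- All streets of `g` join nodes of `O`. -/
def Within (g : V → Option V) (O : Finset V) : Prop := ∀ v w, g v = some w → v ∈ O ∧ w ∈ O

theorem Within.none {g : V → Option V} {O : Finset V} (h : Within g O) {v : V} (hv : v ∉ O) :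
    g v = none := by
  cases hg : g v with
  | none => rfl
  | some w => exact absurd (h v w hg).1 hv

theorem Within.mem_iff {g : V → Option V} {O : Finset V} (h : Within g O) {v r : V}
    (hv : Leads g v r) : v ∈ O ↔ r ∈ O := by
  induction hv with
  | root _ => rfl
  | step h1 _ ih => exact ⟨fun _ => ih.1 (h _ _ h1).2, fun _ => (h _ _ h1).1⟩

theorem Within.update {g : V → Option V} {O : Finset V} (h : Within g O) {r x : V} (hr : r ∈ O)
    (hx : x ∈ O) : Within (Function.update g r (some x)) O := by
  intro v w hv
  by_cases hvr : v = r
  · subst hvr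
    simp only [Function.update_self, Option.some.injEq] at hv
    exact ⟨hr, hv ▸ hx⟩
  · rw [Function.update_of_ne hvr] at hv
    exact h v w hv

theorem Within.mono {g : V → Option V} {O O' : Finset V} (h : Within g O) (hO : O ⊆ O') :
    Within g O' := fun v w hv => ⟨hO (h v w hv).1, hO (h v w hv).2⟩

theorem comp_nonempty {g : V → Option V} {r : V} (hr : g r = none) : r ∈ comp g r :=
  mem_comp.2 (.root hr)

theorem comp_injOn (g : V → Option V) (O : Finset V) :
    Set.InjOn (comp g) (rootsIn g O : Set V) := by
  intro r hr r' _ h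
  have : r ∈ comp g r' := h ▸ comp_nonempty (mem_rootsIn.1 hr).2
  exact (Leads.root (mem_rootsIn.1 hr).2).unique (mem_comp.1 this)

theorem biUnion_comp {g : V → Option V} (hg : IsForest g) {O : Finset V} (hO : Within g O) :
    (rootsIn g O).biUnion (comp g) = O := by
  ext v
  simp only [mem_biUnion, mem_rootsIn, mem_comp]
  constructor
  · rintro ⟨r, ⟨hr, _⟩, h⟩
    exact (hO.mem_iff h).2 hr
  · intro hv
    obtain ⟨r, hr⟩ := hg v
    exact ⟨r, ⟨(hO.mem_iff hr).1 hv, hr.target⟩, hr⟩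

theorem comp_subset {g : V → Option V} {O : Finset V} (hO : Within g O) {r : V} (hr : r ∈ O) :
    comp g r ⊆ O := fun _ hv => (hO.mem_iff (mem_comp.1 hv)).2 hr

theorem comp_disjoint (g : V → Option V) {r r' : V} (h : r ≠ r') :
    Disjoint (comp g r) (comp g r') := by
  rw [Finset.disjoint_left]
  exact fun v hv hv' => h ((mem_comp.1 hv).unique (mem_comp.1 hv'))

/-- Summation over all nodes, grouped into the trees of a forest. -/
theorem sum_by_comp {M : Type*} [AddCommMonoid M] {g : V → Option V} (hg : IsForest g)
    {O : Finset V} (hO : Within g O) (f : V → M) :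
    ∑ v, f v = (∑ r ∈ rootsIn g O, ∑ v ∈ comp g r, f v) + ∑ v ∈ Oᶜ, f v := by
  rw [← Finset.sum_add_sum_compl O f]
  congr 1
  conv_lhs => rw [← biUnion_comp hg hO]
  exact sum_biUnion fun r _ r' _ h => comp_disjoint g h

theorem extCount_of_not_mem (Fam : Finset (V → Option V)) (g : V → Option V) {O : Finset V}
    {v : V} (hv : v ∉ O) (l : List V) :
    extCount Fam g O (v :: l) = extCount Fam g (insert v O) l := by
  classical
  unfold extCount
  congr 1
  exact Finset.filter_congr fun F _ => and_congr_right fun _ => allPark_cons_of_not_mem hv l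

/-- Every net extending `g` contains the streets from `v` to `r`, and all nodes on the way are
occupied, so the driver may as well start at `r`. -/
theorem extCount_of_leads (Fam : Finset (V → Option V)) {g : V → Option V} {O : Finset V}
    (hO : Within g O) {v r : V} (h : Leads g v r) (hr : r ∈ O) (l : List V) :
    extCount Fam g O (v :: l) = extCount Fam g O (r :: l) := by
  classical
  unfold extCount
  congr 1
  refine Finset.filter_congr fun F _ => and_congr_right fun hF => ?_
  induction h with
  | root _ => rfl
  | step h1 _ ih => rw [allPark_cons_of_mem (hO _ _ h1).1 (hF _ _ h1), ih hr]

/-- The nets are sorted by the street leaving `r`; a net with no street there strands the driver and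
contributes nothing. -/
theorem extCount_root (Fam : Finset (V → Option V)) {g : V → Option V} {O : Finset V} {r : V}
    (hr : r ∈ O) (hg : g r = none) (l : List V) :
    extCount Fam g O (r :: l) =
      ∑ x, extCount Fam (Function.update g r (some x)) O (x :: l) := by
  classical
  unfold extCount
  rw [← Finset.card_biUnion]
  · congr 1
    ext F
    simp only [Finset.mem_filter, Finset.mem_biUnion, Finset.mem_univ, true_and,
      extends_update_iff hg]
    constructor
    · rintro ⟨h1, h2, h3⟩
      cases hF : F r with
      | none =>
        obtain ⟨w, hw, _⟩ := h3
        exact absurd hw (not_drives_of_none hr hF)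
      | some x => exact ⟨x, h1, ⟨h2, rfl⟩, (allPark_cons_of_mem hr hF l).1 h3⟩
    · rintro ⟨x, h1, ⟨h2, hF⟩, h3⟩
      exact ⟨h1, h2, (allPark_cons_of_mem hr hF l).2 h3⟩
  · intro x _ y _ hxy
    refine Finset.disjoint_left.2 fun F hF hF' => ?_
    simp only [Finset.mem_filter, extends_update_iff hg] at hF hF'
    have := hF.2.1.2.symm.trans hF'.2.1.2
    exact hxy (Option.some.inj this)

/-- With the new street the tree of `r` becomes a closed set of occupied nodes, from which the
driver cannot escape. -/
theorem extCount_cycle (Fam : Finset (V → Option V)) {g : V → Option V} {O : Finset V}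
    (hO : Within g O) {r x : V} (hr : r ∈ O) (hg : g r = none) (hx : Leads g x r) (l : List V) :
    extCount Fam (Function.update g r (some x)) O (x :: l) = 0 := by
  classical
  unfold extCount
  rw [Finset.card_eq_zero, Finset.filter_eq_empty_iff]
  rintro F _ ⟨hF, w, hw, _⟩
  rw [extends_update_iff hg] at hF
  refine not_drives_of_closed (K := (comp g r : Set V))
    (by exact_mod_cast comp_subset hO hr) ?_ (mem_comp.2 hx) hw
  intro v hv u hu
  rw [Finset.mem_coe, mem_comp] at hv ⊢
  cases hv with
  | root _ =>
    rw [hF.2] at hu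
    cases hu
    exact hx
  | step h1 h2 =>
    rw [hF.1 _ _ h1] at hu
    cases hu
    exact h2

theorem comp_update_of_ne {g : V → Option V} (hg : IsForest g) {r x y : V} (hr : g r = none)
    (hx : Leads g x y) (hy : y ≠ r) {z : V} (hz : z ≠ r) (hzy : z ≠ y) :
    comp (Function.update g r (some x)) z = comp g z := by
  ext v
  simp [mem_comp, leads_update_iff hg hr hx hy, hz, hzy]

theorem comp_update_target {g : V → Option V} (hg : IsForest g) {r x y : V} (hr : g r = none)
    (hx : Leads g x y) (hy : y ≠ r) :
    comp (Function.update g r (some x)) y = comp g r ∪ comp g y := by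
  ext v
  simp [mem_comp, leads_update_iff hg hr hx hy, hy]

theorem rootsIn_update {g : V → Option V} {r x : V} (O : Finset V) :
    rootsIn (Function.update g r (some x)) O = (rootsIn g O).erase r := by
  ext v
  by_cases h : v = r
  · subst h
    simp [mem_rootsIn]
  · simp [mem_rootsIn, h]

theorem rootsIn_insert {g : V → Option V} {O : Finset V} {x : V} (hx : g x = none) :
    rootsIn g (insert x O) = insert x (rootsIn g O) := by
  simp [rootsIn, Finset.filter_insert, hx]

/-! ### The process on set partitions, and its agreement with the count of nets. -/

/-- The weighted number of ways to continue from a state with occupied nodes partitioned into the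
blocks of `P` and the block `U` which the current driver has already traversed. -/
noncomputable def stateWeight (m : ℕ) (c : ℕ → ℚ) (P : Finset (Finset V)) (U : Finset V) : ℚ :=
  if _h : (U ∪ P.sup id).card < m then
    ∑ B ∈ P.attach, (B.1.card : ℚ) * stateWeight m c (P.erase B.1) (U ∪ B.1) +
      ∑ x : {x // x ∈ (U ∪ P.sup id)ᶜ}, stateWeight m c (insert (insert x.1 U) P) ∅
  else c P.card
-- Absorbing a block removes it from `P` and keeps the occupied set; parking adds one occupied node
-- and at most one block. The factor 2 makes the measure drop in both cases.
termination_by 2 * (m - (U ∪ P.sup id).card) + P.card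
decreasing_by
  · have h1 : U ∪ B.1 ∪ (P.erase B.1).sup id = U ∪ P.sup id := by
      conv_rhs => rw [← Finset.insert_erase B.2, Finset.sup_insert]
      simp [Finset.union_assoc]
    rw [h1, Finset.card_erase_of_mem B.2]
    have := Finset.card_pos.2 ⟨_, B.2⟩
    omega
  · have h1 : ∅ ∪ (insert (insert x.1 U) P).sup id = insert x.1 (U ∪ P.sup id) := by
      rw [Finset.sup_insert]
      simp
    have h2 := Finset.card_insert_le (insert x.1 U) P
    rw [h1, Finset.card_insert_of_notMem (Finset.mem_compl.1 x.2)]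
    omega

theorem stateWeight_of_lt {m : ℕ} (c : ℕ → ℚ) {P : Finset (Finset V)} {U O : Finset V}
    (hO : U ∪ P.sup id = O) (h : O.card < m) :
    stateWeight m c P U =
      ∑ B ∈ P, (B.card : ℚ) * stateWeight m c (P.erase B) (U ∪ B) +
        ∑ x ∈ Oᶜ, stateWeight m c (insert (insert x U) P) ∅ := by
  subst hO
  rw [stateWeight, dif_pos h]
  congr 1
  · exact Finset.sum_attach P fun B => (B.card : ℚ) * stateWeight m c (P.erase B) (U ∪ B)
  · exact Finset.sum_coe_sort _ fun x => stateWeight m c (insert (insert x U) P) ∅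

theorem stateWeight_of_eq {m : ℕ} (c : ℕ → ℚ) {P : Finset (Finset V)} {U : Finset V}
    (h : (U ∪ P.sup id).card = m) : stateWeight m c P U = c P.card := by
  rw [stateWeight, dif_neg h.not_lt]

theorem sup_image_comp (g : V → Option V) (R : Finset V) :
    (R.image (comp g)).sup id = R.biUnion (comp g) := by
  rw [Finset.sup_image, Finset.sup_eq_biUnion]
  rfl

theorem sum_image_comp {g : V → Option V} {O R : Finset V} (hR : R ⊆ rootsIn g O)
    (f : Finset V → Finset (Finset V) → ℚ) :
    ∑ B ∈ R.image (comp g), f B ((R.image (comp g)).erase B) =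
      ∑ r ∈ R, f (comp g r) ((R.erase r).image (comp g)) := by
  have hinj := (comp_injOn g O).mono (show (R : Set V) ⊆ rootsIn g O by exact_mod_cast hR)
  rw [Finset.sum_image hinj]
  refine Finset.sum_congr rfl fun r hr => ?_
  congr 1
  ext B
  simp only [Finset.mem_erase, Finset.mem_image]
  constructor
  · rintro ⟨h, t, ht, rfl⟩
    exact ⟨t, ⟨fun h' => h (by rw [h']), ht⟩, rfl⟩
  · rintro ⟨t, ⟨h, ht⟩, rfl⟩
    exact ⟨fun h' => h (hinj ht hr h'), t, ht, rfl⟩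

theorem sum_ofFn_succ {M : Type*} [AddCommMonoid M] (j : ℕ) (f : List V → M) :
    ∑ l : Fin (j + 1) → V, f (List.ofFn l) =
      ∑ v, ∑ l : Fin j → V, f (v :: List.ofFn l) := by
  rw [← Fintype.sum_prod_type', ← (Fin.consEquiv fun _ => V).sum_comp]
  simp [Fin.consEquiv]

/-- Free nodes carry no street of `g`, so each of them is a root in addition to the roots of the
occupied trees. -/
theorem card_rootsIn_univ {g : V → Option V} {O : Finset V} (hO : Within g O) :
    (rootsIn g univ).card = ((rootsIn g O).image (comp g)).card + (Fintype.card V - O.card) := by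
  rw [Finset.card_image_of_injOn (comp_injOn g O), ← Finset.card_compl,
    ← Finset.card_union_of_disjoint]
  · congr 1
    ext v
    simp only [mem_rootsIn, Finset.mem_union, Finset.mem_compl, Finset.mem_univ, true_and]
    by_cases hv : v ∈ O <;> simp [hv, hO.none]
  · rw [Finset.disjoint_left]
    intro v hv
    simpa using (mem_rootsIn.1 hv).1

/-- Handles a driver who has reached the root `r` of the tree traversed so far. A street into
another tree merges two trees and lowers the number of roots, which is the induction parameter; a
street to a free node ends his drive, and `IH` takes over for the remaining drivers. -/
theorem sum_extCount_root {m : ℕ} (c : ℕ → ℚ) {Fam : Finset (V → Option V)} (j : ℕ)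
    (IH : ∀ (g : V → Option V) (O : Finset V), IsForest g → Within g O → O.card + j = m →
      ∑ l : Fin j → V, (extCount Fam g O (List.ofFn l) : ℚ) =
        stateWeight m c ((rootsIn g O).image (comp g)) ∅)
    {g : V → Option V} {O : Finset V} (hg : IsForest g) (hO : Within g O)
    (hj : O.card + (j + 1) = m) {r : V} (hr : r ∈ rootsIn g O) :
    ∑ l : Fin j → V, (extCount Fam g O (r :: List.ofFn l) : ℚ) =
      stateWeight m c (((rootsIn g O).erase r).image (comp g)) (comp g r) := by
  induction hk : (rootsIn g O).card generalizing g r with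
  | zero => simp_all
  | succ k ih =>
    have hrO := (mem_rootsIn.1 hr).1
    have hgr := (mem_rootsIn.1 hr).2
    have hsup : comp g r ∪ (((rootsIn g O).erase r).image (comp g)).sup id = O := by
      rw [sup_image_comp, ← Finset.biUnion_insert, Finset.insert_erase hr, biUnion_comp hg hO]
    rw [stateWeight_of_lt c hsup (by omega)]
    simp_rw [extCount_root Fam hrO hgr, Nat.cast_sum]
    rw [Finset.sum_comm, sum_by_comp hg hO]
    congr 1
    -- The targets in the tree of `r` itself close a cycle and contribute 0, so the sum over roots
    -- reduces to the blocks other than the traversed one.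
    · rw [sum_image_comp (O := O) (Finset.erase_subset _ _) fun B P =>
        (B.card : ℚ) * stateWeight m c P (comp g r ∪ B), ← Finset.add_sum_erase _ _ hr,
        Finset.sum_eq_zero, zero_add]
      · refine Finset.sum_congr rfl fun y hy => ?_
        obtain ⟨hyr, hy⟩ := Finset.mem_erase.1 hy
        have hyO := (mem_rootsIn.1 hy).1
        rw [← nsmul_eq_mul, ← Finset.sum_const]
        refine Finset.sum_congr rfl fun x hx => ?_
        have hx := mem_comp.1 hx
        have hg' := hg.update hgr hx hyr
        have hO' := hO.update hrO ((hO.mem_iff hx).2 hyO)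
        have hroots := rootsIn_update (g := g) (r := r) (x := x) O
        have hx' := hx.update_of_ne (x := x) hyr hgr
        -- The driver moves on to `y`, the root of the merged tree, and the induction hypothesis
        -- applies there.
        simp_rw [extCount_of_leads Fam hO' hx' hyO]
        rw [ih hg' hO' (by rw [hroots]; exact Finset.mem_erase.2 ⟨hyr, hy⟩)
          (by rw [hroots, Finset.card_erase_of_mem hr]; omega), hroots,
          comp_update_target hg hgr hx hyr]
        congr 1
        refine Finset.image_congr fun z hz => ?_
        rw [Finset.mem_coe, Finset.mem_erase, Finset.mem_erase] at hz
        exact comp_update_of_ne hg hgr hx hyr hz.2.1 hz.1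
      · intro x hx
        refine Finset.sum_eq_zero fun l _ => ?_
        rw [extCount_cycle Fam hO hrO hgr (mem_comp.1 hx), Nat.cast_zero]
    · refine Finset.sum_congr rfl fun x hx => ?_
      have hx := Finset.mem_compl.1 hx
      have hxr : x ≠ r := fun h => hx (h ▸ hrO)
      have hgx := hO.none hx
      have hlx : Leads g x x := .root hgx
      have hg' := hg.update hgr hlx hxr
      have hO' := (hO.mono (Finset.subset_insert x O)).update
        (Finset.mem_insert_of_mem hrO) (Finset.mem_insert_self x O)
      simp_rw [extCount_of_not_mem Fam _ hx]
      have hcompx : comp g x = {x} := by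
        ext v
        rw [mem_comp, Finset.mem_singleton]
        constructor
        · intro h
          cases h with
          | root _ => rfl
          | step h1 h2 => exact absurd ((hO.mem_iff h2).1 (hO _ _ h1).2) hx
        · rintro rfl
          exact hlx
      rw [IH _ _ hg' hO' (by rw [Finset.card_insert_of_notMem hx]; omega), rootsIn_update,
        rootsIn_insert hgx, Finset.erase_insert_of_ne hxr, Finset.image_insert,
        comp_update_target hg hgr hlx hxr, hcompx, Finset.union_comm, ← Finset.insert_eq]
      congr 2
      refine Finset.image_congr fun z hz => ?_
      rw [Finset.mem_coe, Finset.mem_erase, mem_rootsIn] at hz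
      exact comp_update_of_ne hg hgr hlx hxr hz.1 fun h => hx (h ▸ hz.2.1)

/-- Each step sees only the sizes of the trees, so the partition determines the count. The shift by
`Fintype.card V - m` accounts for the free nodes, which are roots at the end as well. -/
theorem sum_extCount {m : ℕ} {c : ℕ → ℚ} {Fam : Finset (V → Option V)}
    (hc : ∀ g : V → Option V, IsForest g →
      (extCount Fam g ∅ [] : ℚ) = c ((rootsIn g univ).card))
    (j : ℕ) {g : V → Option V} {O : Finset V} (hg : IsForest g) (hO : Within g O)
    (hj : O.card + j = m) :
    ∑ l : Fin j → V, (extCount Fam g O (List.ofFn l) : ℚ) =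
      stateWeight m (fun k => c (k + (Fintype.card V - m))) ((rootsIn g O).image (comp g)) ∅ := by
  have hsup : ∀ {g : V → Option V} {O : Finset V}, IsForest g → Within g O →
      ∅ ∪ ((rootsIn g O).image (comp g)).sup id = O := by
    intro g O hg hO
    rw [sup_image_comp, biUnion_comp hg hO, Finset.empty_union]
  induction j generalizing g O with
  | zero =>
    rw [stateWeight_of_eq _ (by rw [hsup hg hO]; omega)]
    have : O.card = m := by omega
    subst this
    rw [← card_rootsIn_univ hO, ← hc g hg]
    rw [Fintype.sum_unique, List.ofFn_zero]
    norm_cast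
  | succ j ih =>
    rw [sum_ofFn_succ j fun l => (extCount Fam g O l : ℚ),
      stateWeight_of_lt _ (hsup hg hO) (by omega), sum_by_comp hg hO]
    congr 1
    · rw [sum_image_comp (O := O) subset_rfl fun B P =>
        (B.card : ℚ) * stateWeight m (fun k => c (k + (Fintype.card V - m))) P (∅ ∪ B)]
      refine Finset.sum_congr rfl fun r hr => ?_
      rw [← nsmul_eq_mul, ← Finset.sum_const]
      refine Finset.sum_congr rfl fun x hx => ?_
      simp_rw [extCount_of_leads Fam hO (mem_comp.1 hx) (mem_rootsIn.1 hr).1]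
      rw [sum_extCount_root _ j (fun g O hg hO h => ih hg hO h) hg hO hj hr, Finset.empty_union]
    · refine Finset.sum_congr rfl fun x hx => ?_
      have hx := Finset.mem_compl.1 hx
      have hgx := hO.none hx
      simp_rw [extCount_of_not_mem Fam _ hx]
      have hcompx : comp g x = {x} := by
        ext v
        rw [mem_comp, Finset.mem_singleton]
        constructor
        · intro h
          cases h with
          | root _ => rfl
          | step h1 h2 => exact absurd ((hO.mem_iff h2).1 (hO _ _ h1).2) hx
        · rintro rfl
          exact .root hgx
      rw [ih hg (hO.mono (Finset.subset_insert x O))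
        (by rw [Finset.card_insert_of_notMem hx]; omega), rootsIn_insert hgx,
        Finset.image_insert, hcompx]
      rfl

end Count

/-! ### Set partitions and bijective rearrangements of sums over them. -/

section Partitions

variable {V : Type*} [DecidableEq V]

open Classical in
/-- The set partitions of `S`. -/
noncomputable def parts (S : Finset V) : Finset (Finset (Finset V)) :=
  S.powerset.powerset.filter fun P =>
    ∅ ∉ P ∧ (P : Set (Finset V)).PairwiseDisjoint id ∧ P.sup id = S

theorem mem_parts {S : Finset V} {P : Finset (Finset V)} :
    P ∈ parts S ↔ ∅ ∉ P ∧ (P : Set (Finset V)).PairwiseDisjoint id ∧ P.sup id = S := by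
  classical
  rw [parts, Finset.mem_filter, and_iff_right_iff_imp]
  rintro ⟨_, _, h⟩
  rw [Finset.mem_powerset]
  intro B hB
  rw [Finset.mem_powerset, ← h]
  exact Finset.le_sup (f := id) hB

theorem subset_of_mem_parts {S B : Finset V} {P : Finset (Finset V)} (hP : P ∈ parts S)
    (hB : B ∈ P) : B ⊆ S := by
  rw [← (mem_parts.1 hP).2.2]
  exact Finset.le_sup (f := id) hB

theorem parts_empty : parts (∅ : Finset V) = {∅} := by
  ext P
  rw [Finset.mem_singleton]
  constructor
  · intro h
    rw [Finset.eq_empty_iff_forall_notMem]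
    intro B hB
    have := Finset.subset_empty.1 (subset_of_mem_parts h hB)
    exact (mem_parts.1 h).1 (this ▸ hB)
  · rintro rfl
    simp [mem_parts]

theorem sum_card_parts {S : Finset V} {P : Finset (Finset V)} (hP : P ∈ parts S) :
    ∑ B ∈ P, B.card = S.card := by
  obtain ⟨_, h2, h3⟩ := mem_parts.1 hP
  rw [← h3, Finset.sup_eq_biUnion, Finset.card_biUnion h2]
  rfl

theorem erase_mem_parts {S B : Finset V} {P : Finset (Finset V)} (hP : P ∈ parts S)
    (hB : B ∈ P) : P.erase B ∈ parts (S \ B) := by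
  obtain ⟨h1, h2, h3⟩ := mem_parts.1 hP
  refine mem_parts.2 ⟨fun h => h1 (Finset.mem_of_mem_erase h),
    h2.subset (by exact_mod_cast Finset.erase_subset _ _), ?_⟩
  have hd : Disjoint B ((P.erase B).sup id) := by
    rw [Finset.disjoint_sup_right]
    intro C hC
    exact h2 hB (Finset.mem_of_mem_erase hC) (Finset.ne_of_mem_erase hC).symm
  rw [← h3]
  conv_rhs => rw [← Finset.insert_erase hB, Finset.sup_insert]
  rw [id, Finset.sup_eq_union, Finset.union_sdiff_cancel_left hd]

theorem not_mem_of_mem_parts_sdiff {S B : Finset V} {P : Finset (Finset V)}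
    (hP : P ∈ parts (S \ B)) : B ∉ P := by
  intro h
  have h1 : B = ∅ := by
    have := subset_of_mem_parts hP h
    rw [Finset.eq_empty_iff_forall_notMem]
    intro x hx
    exact (Finset.mem_sdiff.1 (this hx)).2 hx
  exact (mem_parts.1 hP).1 (h1 ▸ h)

theorem insert_mem_parts {S B : Finset V} {P : Finset (Finset V)} (hP : P ∈ parts (S \ B))
    (hB : B ∈ S.powerset.erase ∅) : insert B P ∈ parts S := by
  obtain ⟨h1, h2, h3⟩ := mem_parts.1 hP
  obtain ⟨hB0, hBS⟩ := Finset.mem_erase.1 hB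
  rw [Finset.mem_powerset] at hBS
  refine mem_parts.2 ⟨?_, ?_, ?_⟩
  · rw [Finset.mem_insert, not_or]
    exact ⟨hB0.symm, h1⟩
  · rw [Finset.coe_insert]
    refine h2.insert fun C hC _ => ?_
    exact Finset.disjoint_of_subset_right (subset_of_mem_parts hP hC) Finset.disjoint_sdiff
  · rw [Finset.sup_insert, h3, id, Finset.sup_eq_union, Finset.union_sdiff_of_subset hBS]

/-- Summation over set partitions with a distinguished block. -/
theorem sum_parts_block {M : Type*} [AddCommMonoid M] (S : Finset V)
    (f : Finset V → Finset (Finset V) → M) :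
    ∑ P ∈ parts S, ∑ B ∈ P, f B (P.erase B) =
      ∑ B ∈ S.powerset.erase ∅, ∑ P ∈ parts (S \ B), f B P := by
  rw [Finset.sum_sigma', Finset.sum_sigma']
  refine Finset.sum_bij' (fun p _ => ⟨p.2, p.1.erase p.2⟩) (fun p _ => ⟨insert p.1 p.2, p.1⟩)
    ?_ ?_ ?_ ?_ ?_
  · rintro ⟨P, B⟩ h
    obtain ⟨hP, hB⟩ := Finset.mem_sigma.1 h
    refine Finset.mem_sigma.2 ⟨Finset.mem_erase.2 ⟨?_, ?_⟩, erase_mem_parts hP hB⟩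
    · rintro h0
      exact (mem_parts.1 hP).1 (h0 ▸ hB)
    · exact Finset.mem_powerset.2 (subset_of_mem_parts hP hB)
  · rintro ⟨B, P⟩ h
    obtain ⟨hB, hP⟩ := Finset.mem_sigma.1 h
    exact Finset.mem_sigma.2 ⟨insert_mem_parts hP hB, Finset.mem_insert_self _ _⟩
  · rintro ⟨P, B⟩ h
    obtain ⟨hP, hB⟩ := Finset.mem_sigma.1 h
    simp only [Finset.insert_erase hB]
  · rintro ⟨B, P⟩ h
    obtain ⟨hB, hP⟩ := Finset.mem_sigma.1 h
    simp only [Finset.erase_insert (not_mem_of_mem_parts_sdiff hP)]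
  · intros
    rfl

/-- A traversed set `U` together with the next absorbed block `B` is the same as the enlarged set `U
∪ B` with its last block `B` recorded. -/
theorem sum_powerset_sdiff_block {M : Type*} [AddCommMonoid M] (S : Finset V)
    (f : Finset V → Finset V → M) :
    ∑ U ∈ S.powerset, ∑ B ∈ (S \ U).powerset.erase ∅, f (U ∪ B) B =
      ∑ U ∈ S.powerset.erase ∅, ∑ B ∈ U.powerset.erase ∅, f U B := by
  rw [Finset.sum_sigma', Finset.sum_sigma']
  refine Finset.sum_bij' (fun p _ => ⟨p.1 ∪ p.2, p.2⟩) (fun p _ => ⟨p.1 \ p.2, p.2⟩)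
    ?_ ?_ ?_ ?_ ?_
  · rintro ⟨U, B⟩ h
    simp only [Finset.mem_sigma, Finset.mem_powerset, Finset.mem_erase,
      Finset.subset_sdiff] at h ⊢
    obtain ⟨h1, h2, h3, h4⟩ := h
    refine ⟨⟨fun h => h2 (Finset.union_eq_empty.1 h).2, Finset.union_subset h1 h3⟩, h2,
      Finset.subset_union_right⟩
  · rintro ⟨U, B⟩ h
    simp only [Finset.mem_sigma, Finset.mem_powerset, Finset.mem_erase,
      Finset.subset_sdiff] at h ⊢
    obtain ⟨⟨h1, h2⟩, h3, h4⟩ := h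
    exact ⟨Finset.sdiff_subset.trans h2, h3, h4.trans h2, Finset.disjoint_sdiff⟩
  · rintro ⟨U, B⟩ h
    simp only [Finset.mem_sigma, Finset.mem_powerset, Finset.mem_erase,
      Finset.subset_sdiff] at h
    simp only [Finset.union_sdiff_cancel_right h.2.2.2.symm]
  · rintro ⟨U, B⟩ h
    simp only [Finset.mem_sigma, Finset.mem_powerset, Finset.mem_erase] at h
    simp only [Finset.sdiff_union_of_subset h.2.2]
  · intros
    rfl

/-- Parking at a free node `x` turns `U` into the block `B = insert x U`; conversely `x` is
recovered as a marked element of `B`. -/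
theorem sum_powersetCard_succ_mark [Fintype V] {M : Type*} [AddCommMonoid M] (k : ℕ)
    (f : Finset V → Finset V → V → M) :
    ∑ S ∈ powersetCard k univ, ∑ U ∈ S.powerset, ∑ x ∈ Sᶜ, f (S \ U) U x =
      ∑ S ∈ powersetCard (k + 1) univ, ∑ B ∈ S.powerset.erase ∅, ∑ x ∈ B,
        f (S \ B) (B.erase x) x := by
  simp_rw [Finset.sum_sigma']
  refine Finset.sum_bij' (fun p _ => ⟨insert p.2.2 p.1, insert p.2.2 p.2.1, p.2.2⟩)
    (fun p _ => ⟨p.1.erase p.2.2, p.2.1.erase p.2.2, p.2.2⟩) ?_ ?_ ?_ ?_ ?_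
  · rintro ⟨S, U, x⟩ h
    simp only [Finset.mem_sigma, Finset.mem_powersetCard, Finset.mem_powerset,
      Finset.mem_compl, Finset.mem_erase, Finset.subset_univ, true_and] at h ⊢
    obtain ⟨h1, h2, h3⟩ := h
    exact ⟨by rw [Finset.card_insert_of_notMem h3, h1],
      ⟨Finset.insert_ne_empty _ _, Finset.insert_subset_insert _ h2⟩, Finset.mem_insert_self _ _⟩
  · rintro ⟨S, B, x⟩ h
    simp only [Finset.mem_sigma, Finset.mem_powersetCard, Finset.mem_powerset,
      Finset.mem_compl, Finset.mem_erase, Finset.subset_univ, true_and] at h ⊢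
    obtain ⟨h1, ⟨h2, h4⟩, h3⟩ := h
    exact ⟨by rw [Finset.card_erase_of_mem (h4 h3), h1]; rfl, Finset.erase_subset_erase _ h4,
      fun h => h.1 rfl⟩
  · rintro ⟨S, U, x⟩ h
    simp only [Finset.mem_sigma, Finset.mem_powersetCard, Finset.mem_powerset,
      Finset.mem_compl, Finset.subset_univ, true_and] at h
    simp only [Finset.erase_insert h.2.2, Finset.erase_insert fun h' => h.2.2 (h.2.1 h')]
  · rintro ⟨S, B, x⟩ h
    simp only [Finset.mem_sigma, Finset.mem_powersetCard, Finset.mem_powerset,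
      Finset.mem_erase, Finset.subset_univ, true_and] at h
    simp only [Finset.insert_erase h.2.2, Finset.insert_erase (h.2.1.2 h.2.2)]
  · rintro ⟨S, U, x⟩ h
    simp only [Finset.mem_sigma, Finset.mem_powersetCard, Finset.mem_powerset,
      Finset.mem_compl, Finset.subset_univ, true_and] at h
    simp only [Finset.erase_insert fun h' => h.2.2 (h.2.1 h')]
    congr 1
    rw [Finset.insert_sdiff_insert, Finset.sdiff_insert_of_notMem h.2.2]

end Partitions

/-! ### Catalan weights of clusters and the exponential formula. -/

section Clusters

/-- The number of ways in which a driver can traverse a cluster of `u` nodes, together with the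
history of that cluster. -/
def clusterWeight (u : ℕ) : ℚ := (u.factorial : ℚ) * (catalan u : ℚ)

theorem clusterWeight_zero : clusterWeight 0 = 1 := by simp [clusterWeight]

/-- Since k · (k-1)! = k!, the factorials cancel the binomial coefficient, and the binomial
convolution becomes a Cauchy product shifted by one. The factor k removes the term k = 0, where `k -
1` is truncated. -/
theorem sum_choose_pred {u : ℕ} (a b : ℕ → ℚ) :
    ∑ k ∈ range (u + 2), ((u + 1).choose k : ℚ) *
        ((k : ℚ) * ((k - 1).factorial * a (k - 1)) *
          ((u + 1 - k).factorial * b (u + 1 - k))) =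
      (u + 1).factorial * ∑ p ∈ antidiagonal u, a p.1 * b p.2 := by
  rw [Finset.sum_range_succ', Finset.Nat.sum_antidiagonal_eq_sum_range_succ_mk, Finset.mul_sum]
  simp only [Nat.cast_zero, zero_mul, mul_zero, add_zero]
  refine Finset.sum_congr rfl fun k hk => ?_
  have hk' : k + 1 ≤ u + 1 := by
    have := Finset.mem_range.1 hk
    omega
  rw [← Nat.choose_mul_factorial_mul_factorial hk', Nat.add_sub_cancel, Nat.factorial_succ k,
    Nat.add_sub_add_right]
  push_cast
  ring

/-- This is the Catalan recurrence in exponential form. `B` is the block absorbed last: it can be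
entered at any of its `B.card` nodes, and `U \ B` was traversed before. -/
theorem clusterWeight_rec {V : Type*} [DecidableEq V] {U : Finset V} (hU : U ≠ ∅) :
    ∑ B ∈ U.powerset.erase ∅,
      (B.card : ℚ) * clusterWeight (B.card - 1) * clusterWeight (U \ B).card =
      clusterWeight U.card := by
  have h0 : ∑ B ∈ U.powerset.erase ∅,
      (B.card : ℚ) * clusterWeight (B.card - 1) * clusterWeight (U \ B).card =
      ∑ B ∈ U.powerset,
        (B.card : ℚ) * clusterWeight (B.card - 1) * clusterWeight (U.card - B.card) := by
    rw [← Finset.add_sum_erase U.powerset _ (Finset.empty_mem_powerset U)]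
    simp only [Finset.card_empty, Nat.cast_zero, zero_mul, zero_add]
    refine Finset.sum_congr rfl fun B hB => ?_
    rw [Finset.card_sdiff_of_subset (Finset.mem_powerset.1 (Finset.mem_of_mem_erase hB))]
  rw [h0, Finset.sum_powerset_apply_card fun k =>
    (k : ℚ) * clusterWeight (k - 1) * clusterWeight (U.card - k)]
  obtain ⟨u, hu⟩ : ∃ u, U.card = u + 1 :=
    Nat.exists_eq_succ_of_ne_zero (by rwa [Ne, Finset.card_eq_zero])
  rw [hu]
  simp only [nsmul_eq_mul]
  unfold clusterWeight
  rw [sum_choose_pred (fun k => (catalan k : ℚ)) fun k => (catalan k : ℚ), catalan_succ']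
  push_cast
  rfl

variable {V : Type*} [Fintype V] [DecidableEq V]

/-- One driver does not change the total weight. -/
theorem sum_parts_stateWeight_succ {m k : ℕ} (c : ℕ → ℚ) (hk : k < m) :
    ∑ S ∈ powersetCard k (univ : Finset V), ∑ P ∈ parts S,
        (∏ B ∈ P, clusterWeight (B.card - 1)) * stateWeight m c P ∅ =
      (k + 1 : ℕ) * ∑ S ∈ powersetCard (k + 1) (univ : Finset V), ∑ P ∈ parts S,
        (∏ B ∈ P, clusterWeight (B.card - 1)) * stateWeight m c P ∅ := by
  set w : Finset (Finset V) → ℚ := fun P => ∏ B ∈ P, clusterWeight (B.card - 1) with hw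
  have hmul : ∀ {B : Finset V} {P : Finset (Finset V)}, B ∈ P →
      clusterWeight (B.card - 1) * w (P.erase B) = w P := fun {B P} hB =>
    Finset.mul_prod_erase P (fun B => clusterWeight (B.card - 1)) hB
  have step : ∀ S ∈ powersetCard k (univ : Finset V),
      ∑ P ∈ parts S, w P * stateWeight m c P ∅ =
        ∑ U ∈ S.powerset, ∑ x ∈ Sᶜ, ∑ P ∈ parts (S \ U),
          w P * clusterWeight U.card * stateWeight m c (insert (insert x U) P) ∅ := by
    intro S hS
    have hSk := (Finset.mem_powersetCard.1 hS).2
    have h1 : ∑ U ∈ S.powerset, ∑ P ∈ parts (S \ U),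
        w P * clusterWeight U.card * stateWeight m c P U =
        (∑ U ∈ S.powerset.erase ∅, ∑ P ∈ parts (S \ U),
          w P * clusterWeight U.card * stateWeight m c P U) +
        ∑ U ∈ S.powerset, ∑ x ∈ Sᶜ, ∑ P ∈ parts (S \ U),
          w P * clusterWeight U.card * stateWeight m c (insert (insert x U) P) ∅ := by
      -- One step of the process is applied to every intermediate state, with `U` weighted by
      -- `clusterWeight U.card`.
      have h2 : ∀ U ∈ S.powerset, ∀ P ∈ parts (S \ U),
          w P * clusterWeight U.card * stateWeight m c P U =
          (∑ B ∈ P, clusterWeight (B.card - 1) * w (P.erase B) * clusterWeight U.card *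
            (B.card * stateWeight m c (P.erase B) (U ∪ B))) +
          ∑ x ∈ Sᶜ, w P * clusterWeight U.card *
            stateWeight m c (insert (insert x U) P) ∅ := by
        intro U hU P hP
        have hO : U ∪ P.sup id = S := by
          rw [(mem_parts.1 hP).2.2]
          exact Finset.union_sdiff_of_subset (Finset.mem_powerset.1 hU)
        rw [stateWeight_of_lt c hO (by omega), mul_add, Finset.mul_sum, Finset.mul_sum]
        congr 1
        refine Finset.sum_congr rfl fun B hB => ?_
        rw [hmul hB]
      rw [Finset.sum_congr rfl fun U hU => Finset.sum_congr rfl (h2 U hU)]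
      simp_rw [Finset.sum_add_distrib]
      congr 1
      · have h3 : ∀ U ∈ S.powerset, ∑ P ∈ parts (S \ U), ∑ B ∈ P,
            clusterWeight (B.card - 1) * w (P.erase B) * clusterWeight U.card *
              (B.card * stateWeight m c (P.erase B) (U ∪ B)) =
            ∑ B ∈ (S \ U).powerset.erase ∅, ∑ P ∈ parts (S \ (U ∪ B)),
              clusterWeight (B.card - 1) * w P * clusterWeight ((U ∪ B) \ B).card *
                (B.card * stateWeight m c P (U ∪ B)) := by
          intro U _
          rw [sum_parts_block (S \ U) fun B P =>
            clusterWeight (B.card - 1) * w P * clusterWeight U.card *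
              (B.card * stateWeight m c P (U ∪ B))]
          refine Finset.sum_congr rfl fun B hB => ?_
          have hd : Disjoint U B := by
            have := Finset.mem_powerset.1 (Finset.mem_of_mem_erase hB)
            exact (Finset.subset_sdiff.1 this).2.symm
          rw [Finset.union_sdiff_cancel_right hd, sdiff_sdiff_left, Finset.sup_eq_union]
        rw [Finset.sum_congr rfl h3, sum_powerset_sdiff_block S fun U B =>
          ∑ P ∈ parts (S \ U), clusterWeight (B.card - 1) * w P * clusterWeight (U \ B).card *
            (B.card * stateWeight m c P U)]
        refine Finset.sum_congr rfl fun U hU => ?_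
        rw [Finset.sum_comm]
        refine Finset.sum_congr rfl fun P _ => ?_
        rw [← clusterWeight_rec (Finset.ne_of_mem_erase hU), Finset.mul_sum, Finset.sum_mul]
        refine Finset.sum_congr rfl fun B _ => ?_
        ring
      · exact Finset.sum_congr rfl fun U _ => Finset.sum_comm
    -- The states with `U ≠ ∅` occur on both sides and cancel. What remains equates the start of the
    -- drive, `U = ∅`, with all the ways of parking.
    rw [← Finset.add_sum_erase _ _ (Finset.empty_mem_powerset S), add_comm] at h1
    have h4 := add_left_cancel h1
    rw [← h4, Finset.sdiff_empty, Finset.card_empty, clusterWeight_zero]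
    simp
  rw [Finset.sum_congr rfl step, sum_powersetCard_succ_mark k fun R U x =>
    ∑ P ∈ parts R, w P * clusterWeight U.card * stateWeight m c (insert (insert x U) P) ∅,
    Finset.mul_sum]
  refine Finset.sum_congr rfl fun S hS => ?_
  have h5 : ∀ B ∈ S.powerset.erase ∅, ∑ x ∈ B, ∑ P ∈ parts (S \ B),
      w P * clusterWeight (B.erase x).card *
        stateWeight m c (insert (insert x (B.erase x)) P) ∅ =
      ∑ P ∈ parts (S \ B), (B.card : ℚ) *
        (clusterWeight (B.card - 1) * w P * stateWeight m c (insert B P) ∅) := by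
    intro B _
    rw [Finset.sum_comm]
    refine Finset.sum_congr rfl fun P _ => ?_
    rw [← nsmul_eq_mul, ← Finset.sum_const]
    refine Finset.sum_congr rfl fun x hx => ?_
    rw [Finset.insert_erase hx, Finset.card_erase_of_mem hx]
    ring
  rw [Finset.sum_congr rfl h5, ← sum_parts_block S fun B P => (B.card : ℚ) *
    (clusterWeight (B.card - 1) * w P * stateWeight m c (insert B P) ∅), Finset.mul_sum]
  refine Finset.sum_congr rfl fun P hP => ?_
  -- The driver's parking node may be any element of the new occupied set; summing block sizes gives
  -- the factor k + 1.
  rw [← (Finset.mem_powersetCard.1 hS).2, ← sum_card_parts hP, Nat.cast_sum, Finset.sum_mul]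
  refine Finset.sum_congr rfl fun B hB => ?_
  rw [hmul hB, Finset.insert_erase hB]

/-- The invariance is applied once for each of the m drivers, and its factors multiply to m!. At m
occupied nodes the process has stopped and `stateWeight` equals `c`. -/
theorem stateWeight_empty_eq (m : ℕ) (c : ℕ → ℚ) :
    stateWeight m c (∅ : Finset (Finset V)) ∅ =
      m.factorial * ∑ S ∈ powersetCard m (univ : Finset V), ∑ P ∈ parts S,
        (∏ B ∈ P, clusterWeight (B.card - 1)) * c P.card := by
  have h : ∀ k ≤ m, stateWeight m c (∅ : Finset (Finset V)) ∅ =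
      k.factorial * ∑ S ∈ powersetCard k (univ : Finset V), ∑ P ∈ parts S,
        (∏ B ∈ P, clusterWeight (B.card - 1)) * stateWeight m c P ∅ := by
    intro k
    induction k with
    | zero => simp [parts_empty]
    | succ k ih =>
      intro hk
      rw [ih (by omega), sum_parts_stateWeight_succ c (by omega), Nat.factorial_succ]
      push_cast
      ring
  rw [h m le_rfl]
  congr 1
  refine Finset.sum_congr rfl fun S hS => Finset.sum_congr rfl fun P hP => ?_
  rw [stateWeight_of_eq]
  rw [(mem_parts.1 hP).2.2, Finset.empty_union]
  exact (Finset.mem_powersetCard.1 hS).2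

/-- The exponential formula for the weights of clusters. -/
theorem sum_parts_pow (t : ℚ) (z : ℕ → ℚ) (hz0 : z 0 = 1)
    (hz : ∀ u : ℕ, (u + 1 : ℚ) * z (u + 1) =
      t * ∑ p ∈ antidiagonal u, (catalan p.1 : ℚ) * z p.2) (S : Finset V) :
    ∑ P ∈ parts S, (∏ B ∈ P, clusterWeight (B.card - 1)) * t ^ P.card =
      S.card.factorial * z S.card := by
  induction hS : S.card using Nat.strong_induction_on generalizing S with
  | _ s ih =>
    cases s with
    | zero =>
      rw [Finset.card_eq_zero] at hS
      subst hS
      simp [parts_empty, hz0]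
    | succ u =>
      have hu : ((u + 1 : ℕ) : ℚ) ≠ 0 := by positivity
      refine mul_left_cancel₀ hu ?_
      -- Multiplying by the size of `S` marks one element, hence a block weighted by its size; this
      -- matches the derivative in z' = t C z, which `hz` expresses in coefficients.
      have h1 : ((u + 1 : ℕ) : ℚ) * ∑ P ∈ parts S,
          (∏ B ∈ P, clusterWeight (B.card - 1)) * t ^ P.card =
          ∑ P ∈ parts S, ∑ B ∈ P, (B.card : ℚ) * clusterWeight (B.card - 1) * t *
            ((∏ B ∈ P.erase B, clusterWeight (B.card - 1)) * t ^ (P.erase B).card) := by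
        rw [Finset.mul_sum]
        refine Finset.sum_congr rfl fun P hP => ?_
        rw [← hS, ← sum_card_parts hP, Nat.cast_sum, Finset.sum_mul]
        refine Finset.sum_congr rfl fun B hB => ?_
        rw [← Finset.mul_prod_erase P _ hB, Finset.card_erase_of_mem hB]
        obtain ⟨p, hp⟩ : ∃ p, P.card = p + 1 :=
          Nat.exists_eq_succ_of_ne_zero (Finset.card_ne_zero_of_mem hB)
        rw [hp, Nat.add_sub_cancel]
        ring
      rw [h1, sum_parts_block S fun B P => (B.card : ℚ) * clusterWeight (B.card - 1) * t *
            ((∏ B ∈ P, clusterWeight (B.card - 1)) * t ^ P.card)]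
      have h2 : ∑ B ∈ S.powerset.erase ∅, ∑ P ∈ parts (S \ B),
          (B.card : ℚ) * clusterWeight (B.card - 1) * t *
            ((∏ B ∈ P, clusterWeight (B.card - 1)) * t ^ P.card) =
          ∑ B ∈ S.powerset, (B.card : ℚ) * clusterWeight (B.card - 1) * t *
            ((u + 1 - B.card).factorial * z (u + 1 - B.card)) := by
        rw [← Finset.add_sum_erase S.powerset _ (Finset.empty_mem_powerset S)]
        simp only [Finset.card_empty, Nat.cast_zero, zero_mul, zero_add]
        refine Finset.sum_congr rfl fun B hB => ?_
        obtain ⟨hB0, hB⟩ := Finset.mem_erase.1 hB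
        have hc := Finset.card_sdiff_of_subset (Finset.mem_powerset.1 hB)
        have hpos := Finset.card_pos.2 (Finset.nonempty_iff_ne_empty.2 hB0)
        rw [← Finset.mul_sum, ih _ (by omega) (S \ B) rfl, hc, hS]
      rw [h2, Finset.sum_powerset_apply_card fun k => (k : ℚ) * clusterWeight (k - 1) * t *
            ((u + 1 - k).factorial * z (u + 1 - k)), hS]
      have h3 := sum_choose_pred (u := u) (fun k => (catalan k : ℚ)) z
      have h4 : ((u + 1 : ℕ) : ℚ) * (((u + 1).factorial : ℚ) * z (u + 1)) =
          (u + 1).factorial * (t * ∑ p ∈ antidiagonal u, (catalan p.1 : ℚ) * z p.2) := by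
        rw [← hz]
        push_cast
        ring
      rw [h4, mul_left_comm, ← h3, Finset.mul_sum]
      refine Finset.sum_congr rfl fun k _ => ?_
      rw [nsmul_eq_mul, clusterWeight]
      ring

end Clusters

/-! ### The Catalan power series and extraction of coefficients. -/

section Series

open PowerSeries

/-- The generating function of the Catalan numbers, over `ℚ`. -/
noncomputable def catSeries : ℚ⟦X⟧ := PowerSeries.mk fun k => (catalan k : ℚ)

theorem catSeries_eq : catSeries = 1 + X * catSeries ^ 2 := by
  have h := congrArg (PowerSeries.map (Nat.castRingHom ℚ)) catalanSeries_sq_mul_X_add_one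
  have h' : PowerSeries.map (Nat.castRingHom ℚ) catalanSeries = catSeries := by
    ext k
    simp [catSeries]
  rw [map_add, map_mul, map_pow, h', map_one, map_X] at h
  linear_combination -h

/-- The generating function `X * catSeries`, the solution of `W = X + W ^ 2`. -/
noncomputable def catShift : ℚ⟦X⟧ := X * catSeries

theorem catShift_eq : catShift = X + catShift ^ 2 := by
  have h := catSeries_eq
  unfold catShift
  linear_combination X * h

theorem catSeries_mul_one_sub : catSeries * (1 - catShift) = 1 := by
  have h := catSeries_eq
  unfold catShift
  linear_combination h

/-- The generating function of the Catalan numbers, as a unit. -/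
noncomputable def catUnit : ℚ⟦X⟧ˣ where
  val := catSeries
  inv := 1 - catShift
  val_inv := catSeries_mul_one_sub
  inv_val := by rw [mul_comm, catSeries_mul_one_sub]

theorem coeff_derivative_catShift (k : ℕ) :
    coeff k (d⁄dX ℚ catShift) = (k.centralBinom : ℚ) := by
  rw [coeff_derivative, catShift, coeff_succ_X_mul, catSeries, coeff_mk,
    ← succ_mul_catalan_eq_centralBinom]
  push_cast
  ring

theorem derivative_catShift_mul : d⁄dX ℚ catShift * (1 - 2 * catShift) = 1 := by
  have h := congrArg (d⁄dX ℚ) catShift_eq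
  rw [map_add, derivative_X, derivative_pow] at h
  push_cast at h
  linear_combination h

/-- The equation C = 1 + X C^2 multiplied by C^p W'; on coefficients it becomes Pascal's rule. -/
theorem catUnit_zpow_mul_derivative (p : ℤ) :
    ((catUnit ^ (p + 1) : ℚ⟦X⟧ˣ) : ℚ⟦X⟧) * d⁄dX ℚ catShift =
      ((catUnit ^ p : ℚ⟦X⟧ˣ) : ℚ⟦X⟧) * d⁄dX ℚ catShift +
        X * (((catUnit ^ (p + 2) : ℚ⟦X⟧ˣ) : ℚ⟦X⟧) * d⁄dX ℚ catShift) := by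
  have h := catSeries_eq
  have h1 : (catUnit : ℚ⟦X⟧) = catSeries := rfl
  rw [zpow_add, zpow_add]
  simp only [Units.val_mul, h1, zpow_ofNat, Units.val_pow_eq_pow_val]
  linear_combination ((catUnit ^ p : ℚ⟦X⟧ˣ) : ℚ⟦X⟧) * d⁄dX ℚ catShift * h

theorem eq_of_succ_sub_eq {f g : ℤ → ℚ} (h0 : f 0 = g 0)
    (h : ∀ p, f (p + 1) - f p = g (p + 1) - g p) (p : ℤ) : f p = g p := by
  induction p using Int.induction_on with
  | zero => exact h0
  | succ p ih => linarith [h p]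
  | pred p ih =>
    have := h (-p - 1)
    rw [sub_add_cancel] at this
    linarith

/-- By induction on k, both sides have the same difference in p, by Pascal's rule. They agree at p =
0, where both are central binomial coefficients. Differences determine the values for negative p
too. -/
theorem coeff_catUnit_zpow_mul_derivative (k : ℕ) (p : ℤ) :
    coeff k (((catUnit ^ p : ℚ⟦X⟧ˣ) : ℚ⟦X⟧) * d⁄dX ℚ catShift) =
      ((Ring.choose (2 * (k : ℤ) + p) k : ℤ) : ℚ) := by
  induction k generalizing p with
  | zero =>
    refine eq_of_succ_sub_eq (f := fun p =>
      coeff 0 (((catUnit ^ p : ℚ⟦X⟧ˣ) : ℚ⟦X⟧) * d⁄dX ℚ catShift))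
      (g := fun p => ((Ring.choose (2 * ((0 : ℕ) : ℤ) + p) 0 : ℤ) : ℚ)) ?_ (fun p => ?_) p
    · simp [-coeff_zero_eq_constantCoeff, coeff_derivative_catShift]
    · simp only [catUnit_zpow_mul_derivative, map_add, Ring.choose_zero_right]
      simp
  | succ k ih =>
    refine eq_of_succ_sub_eq (f := fun p =>
      coeff (k + 1) (((catUnit ^ p : ℚ⟦X⟧ˣ) : ℚ⟦X⟧) * d⁄dX ℚ catShift))
      (g := fun p => ((Ring.choose (2 * ((k + 1 : ℕ) : ℤ) + p) (k + 1) : ℤ) : ℚ)) ?_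
      (fun p => ?_) p
    · simp only [zpow_zero, Units.val_one, one_mul, coeff_derivative_catShift, add_zero]
      rw [show (2 * ((k + 1 : ℕ) : ℤ)) = ((2 * (k + 1) : ℕ) : ℤ) by push_cast; ring,
        Ring.choose_natCast, Nat.centralBinom]
      simp
    · simp only [catUnit_zpow_mul_derivative, map_add, coeff_succ_X_mul, ih]
      rw [show 2 * ((k + 1 : ℕ) : ℤ) + (p + 1) = (2 * (k : ℤ) + (p + 2)) + 1 by push_cast; ring,
        show 2 * ((k + 1 : ℕ) : ℤ) + p = 2 * (k : ℤ) + (p + 2) by push_cast; ring,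
        Ring.choose_succ_succ]
      push_cast
      ring

theorem hasSubst_catShift : HasSubst catShift :=
  HasSubst.of_constantCoeff_zero' (by simp [catShift])

theorem coeff_catShift_pow_mul (m j : ℕ) (G : ℚ⟦X⟧) :
    coeff m (catShift ^ j * G) = if j ≤ m then coeff (m - j) (catSeries ^ j * G) else 0 := by
  rw [catShift, mul_pow, mul_assoc, coeff_X_pow_mul']

/-- `catShift ^ j` is divisible by X^j, so only the indices j ≤ i contribute; the looser bound m
lets all coefficients up to m share one range. -/
theorem coeff_subst_catShift (h : ℚ⟦X⟧) {i m : ℕ} (hi : i ≤ m) :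
    coeff i (h.subst catShift) = ∑ j ∈ range (m + 1), coeff j h * coeff i (catShift ^ j) := by
  rw [coeff_subst' hasSubst_catShift, finsum_eq_sum_of_support_subset]
  · rfl
  · intro j hj
    rw [Finset.coe_range, Set.mem_Iio]
    by_contra hcon
    refine hj ?_
    have := coeff_catShift_pow_mul i j 1
    rw [mul_one, if_neg (by omega)] at this
    simp [this]

theorem coeff_subst_catShift_mul (h G : ℚ⟦X⟧) (m : ℕ) :
    coeff m (h.subst catShift * G) =
      ∑ j ∈ range (m + 1), coeff j h * coeff (m - j) (catSeries ^ j * G) := by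
  have h1 : coeff m (h.subst catShift * G) =
      ∑ j ∈ range (m + 1), coeff j h * coeff m (catShift ^ j * G) := by
    simp_rw [coeff_mul m (catShift ^ _), Finset.mul_sum]
    rw [Finset.sum_comm, coeff_mul]
    refine Finset.sum_congr rfl fun p hp => ?_
    have hp' := Finset.HasAntidiagonal.mem_antidiagonal.1 hp
    rw [coeff_subst_catShift h (m := m) (by omega), Finset.sum_mul]
    exact Finset.sum_congr rfl fun j _ => mul_assoc _ _ _
  rw [h1]
  refine Finset.sum_congr rfl fun j hj => ?_
  rw [coeff_catShift_pow_mul, if_pos (by have := Finset.mem_range.1 hj; omega)]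

/-- The power series of `x ↦ exp (a * x)`. -/
noncomputable def expSeries (a : ℚ) : ℚ⟦X⟧ :=
  PowerSeries.mk fun j => a ^ j / (j.factorial : ℚ)

theorem derivative_expSeries (a : ℚ) : d⁄dX ℚ (expSeries a) = C a * expSeries a := by
  ext j
  rw [coeff_derivative, coeff_C_mul, expSeries, coeff_mk, coeff_mk, Nat.factorial_succ]
  have : (j.factorial : ℚ) ≠ 0 := by positivity
  have : (j : ℚ) + 1 ≠ 0 := by positivity
  push_cast
  field_simp
  ring

/-- The exponential generating function of weighted forests of occupied nodes. -/
noncomputable def forestSeries (n : ℕ) : ℚ⟦X⟧ :=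
  (expSeries (2 * n)).subst catShift * (1 - catShift) ^ n

theorem derivative_subst_expSeries (a : ℚ) :
    d⁄dX ℚ ((expSeries a).subst catShift) =
      C a * (expSeries a).subst catShift * d⁄dX ℚ catShift := by
  rw [derivative_subst hasSubst_catShift, derivative_expSeries, subst_mul hasSubst_catShift,
    subst_C]
  rfl

/-- Formally the series is exp(n (2W + log(1-W))), and the exponent has derivative n (1-2W)/(1-W) ·
W' = n/(1-W) = n C, because W' (1-2W) = 1. -/
theorem derivative_forestSeries (n : ℕ) :
    d⁄dX ℚ (forestSeries n) = C (n : ℚ) * (catSeries * forestSeries n) := by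
  cases n with
  | zero =>
    simp [forestSeries, derivative_subst_expSeries]
  | succ k =>
    have h1 := derivative_catShift_mul
    have h2 := catSeries_mul_one_sub
    rw [forestSeries, Derivation.leibniz, derivative_subst_expSeries, derivative_pow, map_sub,
      derivative_one, smul_eq_mul, smul_eq_mul, Nat.add_sub_cancel, map_mul]
    have h3 : (C (2 : ℚ) : ℚ⟦X⟧) = 2 := map_ofNat _ 2
    have h4 : (C ((k + 1 : ℕ) : ℚ) : ℚ⟦X⟧) = ((k + 1 : ℕ) : ℚ⟦X⟧) := map_natCast _ _
    rw [h3, h4, pow_succ]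
    set E := (expSeries (2 * ((k + 1 : ℕ) : ℚ))).subst catShift
    linear_combination ((k + 1 : ℕ) : ℚ⟦X⟧) * E * (1 - catShift) ^ k * (h1 - h2)

theorem forestSeries_zero (n : ℕ) : coeff 0 (forestSeries n) = 1 := by
  have h := coeff_subst_catShift_mul (expSeries (2 * n)) ((1 - catShift) ^ n) 0
  rw [forestSeries, h]
  simp [expSeries, catShift]

theorem forestSeries_rec (n u : ℕ) :
    ((u : ℚ) + 1) * coeff (u + 1) (forestSeries n) =
      n * ∑ p ∈ antidiagonal u, (catalan p.1 : ℚ) * coeff p.2 (forestSeries n) := by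
  have h := congrArg (coeff u) (derivative_forestSeries n)
  rw [coeff_derivative, coeff_C_mul, coeff_mul] at h
  rw [mul_comm, h]
  simp [catSeries]

/-- Inserting W' (1-2W) = 1 writes n z as h(W) C^(-n) W' with h(w) = n (1-2w) exp(2nw), so that the
coefficients of C^p W' become available. -/
theorem coeff_forestSeries (n m : ℕ) :
    (n : ℚ) * coeff m (forestSeries n) =
      ∑ j ∈ range (m + 1),
        ((Ring.choose (2 * (m : ℤ) - (n : ℤ) - (j : ℤ)) (m - j) : ℤ) : ℚ) *
          ((2 * (n : ℚ)) ^ j * ((n : ℚ) - (j : ℚ)) / (j.factorial : ℚ)) := by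
  set h : ℚ⟦X⟧ := PowerSeries.mk fun j =>
    (2 * (n : ℚ)) ^ j * ((n : ℚ) - (j : ℚ)) / (j.factorial : ℚ) with hh
  -- The operator w d/dw multiplies the j-th coefficient by j, which produces the factor n - j.
  have h0 : h = C (n : ℚ) * expSeries (2 * n) - X * d⁄dX ℚ (expSeries (2 * n)) := by
    ext j
    cases j with
    | zero => simp [hh, expSeries]
    | succ j =>
      rw [map_sub, coeff_C_mul, coeff_succ_X_mul, coeff_derivative, hh, expSeries, coeff_mk,
        coeff_mk]
      push_cast
      ring
  have h1 : h.subst catShift =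
      C (n : ℚ) * ((1 - 2 * catShift) * (expSeries (2 * n)).subst catShift) := by
    rw [h0, derivative_expSeries, subst_sub hasSubst_catShift, subst_mul hasSubst_catShift,
      subst_mul hasSubst_catShift, subst_mul hasSubst_catShift, subst_X hasSubst_catShift,
      subst_C, subst_C]
    have h3 : (C (2 * (n : ℚ)) : ℚ⟦X⟧) = 2 * C (n : ℚ) := by
      rw [map_mul]
      congr 1
    change C (n : ℚ) * _ - catShift * (C (2 * (n : ℚ)) * _) = _
    rw [h3]
    ring
  have h2 : C (n : ℚ) * forestSeries n =
      h.subst catShift * (((catUnit ^ (-(n : ℤ)) : ℚ⟦X⟧ˣ) : ℚ⟦X⟧) * d⁄dX ℚ catShift) := by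
    have h4 : ((catUnit ^ (-(n : ℤ)) : ℚ⟦X⟧ˣ) : ℚ⟦X⟧) = (1 - catShift) ^ n := by
      rw [zpow_neg, zpow_natCast, ← inv_pow, Units.val_pow_eq_pow_val]
      rfl
    rw [h1, h4, forestSeries]
    linear_combination -(C (n : ℚ) * (expSeries (2 * n)).subst catShift *
      (1 - catShift) ^ n) * derivative_catShift_mul
  rw [← coeff_C_mul, h2, coeff_subst_catShift_mul]
  refine Finset.sum_congr rfl fun j hj => ?_
  have hj' := Finset.mem_range.1 hj
  -- The power of C in W^j = X^j C^j combines with C^(-n). With p = j - n and k = m - j the upper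
  -- index 2k + p is 2m - n - j.
  have h5 : catSeries ^ j * (((catUnit ^ (-(n : ℤ)) : ℚ⟦X⟧ˣ) : ℚ⟦X⟧) * d⁄dX ℚ catShift) =
      ((catUnit ^ ((j : ℤ) - n) : ℚ⟦X⟧ˣ) : ℚ⟦X⟧) * d⁄dX ℚ catShift := by
    rw [sub_eq_add_neg, zpow_add, Units.val_mul, zpow_natCast, Units.val_pow_eq_pow_val, mul_assoc]
    rfl
  rw [h5, coeff_catUnit_zpow_mul_derivative, hh, coeff_mk, mul_comm]
  congr 3
  push_cast [Nat.cast_sub (show j ≤ m by omega)]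
  ring_nf

end Series

/-! ### Numbers of mappings and of rooted trees extending a given forest. -/

section Families

variable {V : Type*} [Fintype V] [DecidableEq V]

theorem extCount_nil {Fam : Finset (V → Option V)} (g : V → Option V) [DecidablePred
    fun F : V → Option V => Extends F g] :
    extCount Fam g ∅ [] = (Fam.filter fun F => Extends F g).card := by
  classical
  unfold extCount
  congr 1
  ext F
  simp [AllPark]

theorem extends_none (F : V → Option V) : Extends F fun _ => none := by
  intro v w h
  simp at h

/-- Parking functions for the members of a family, counted through the occupied states. -/
theorem card_parking {ι : Type*} [Finite ι] {Fam : Finset (V → Option V)}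
    (φ : ι → V → Option V) (hφ : Function.Injective φ) (hF : ∀ F, F ∈ Fam ↔ ∃ i, φ i = F)
    (m : ℕ) :
    Nat.card {p : ι × (Fin m → V) // IsParkingFunction (φ p.1) p.2} =
      ∑ l : Fin m → V, extCount Fam (fun _ => none) ∅ (List.ofFn l) := by
  classical
  have := Fintype.ofFinite ι
  rw [Nat.card_eq_fintype_card, Fintype.card_subtype]
  have h1 : ∀ l : Fin m → V, extCount Fam (fun _ => none) ∅ (List.ofFn l) =
      (univ.filter fun i => IsParkingFunction (φ i) l).card := by
    intro l
    rw [← Finset.card_image_of_injective _ hφ]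
    unfold extCount
    congr 1
    ext F
    simp only [Finset.mem_filter, Finset.mem_image, Finset.mem_univ, true_and, hF, extends_none,
      isParkingFunction_iff_allPark]
    constructor
    · rintro ⟨⟨i, rfl⟩, h⟩
      exact ⟨i, h, rfl⟩
    · rintro ⟨i, h, rfl⟩
      exact ⟨⟨i, rfl⟩, h⟩
  simp_rw [h1, Finset.card_filter]
  rw [Fintype.sum_prod_type_right]

/-- A family in which the number of extensions of a forest is determined by its number of roots. -/
theorem card_parking_eq {ι : Type*} [Finite ι] {Fam : Finset (V → Option V)}
    (φ : ι → V → Option V) (hφ : Function.Injective φ) (hF : ∀ F, F ∈ Fam ↔ ∃ i, φ i = F)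
    (t b : ℚ)
    (hc : ∀ g : V → Option V, IsForest g →
      (extCount Fam g ∅ [] : ℚ) = t ^ (rootsIn g univ).card * b) (m : ℕ) (z : ℕ → ℚ)
    (hz0 : z 0 = 1)
    (hz : ∀ u : ℕ, (u + 1 : ℚ) * z (u + 1) =
      t * ∑ p ∈ antidiagonal u, (catalan p.1 : ℚ) * z p.2) :
    (Nat.card {p : ι × (Fin m → V) // IsParkingFunction (φ p.1) p.2} : ℚ) =
      m.factorial * ((Fintype.card V).choose m * (m.factorial * z m)) *
        (t ^ (Fintype.card V - m) * b) := by
  rw [card_parking φ hφ hF, Nat.cast_sum,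
    sum_extCount (m := m) (c := fun k => t ^ k * b) hc m (O := ∅)
      (fun v => ⟨v, .root rfl⟩) (fun v w h => by simp at h) (by simp)]
  have h0 : (rootsIn (fun _ : V => (none : Option V)) ∅).image (comp fun _ => none) = ∅ := by
    simp [rootsIn]
  rw [h0, stateWeight_empty_eq, mul_assoc]
  congr 1
  have h1 : ∀ S ∈ powersetCard m (univ : Finset V), ∑ P ∈ parts S,
      (∏ B ∈ P, clusterWeight (B.card - 1)) * (t ^ (P.card + (Fintype.card V - m)) * b) =
      (m.factorial * z m) * (t ^ (Fintype.card V - m) * b) := by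
    intro S hS
    have h2 := sum_parts_pow t z hz0 hz S
    rw [(Finset.mem_powersetCard.1 hS).2] at h2
    rw [← h2, Finset.sum_mul]
    refine Finset.sum_congr rfl fun P _ => ?_
    rw [pow_add]
    ring
  rw [Finset.sum_congr rfl h1, Finset.sum_const, Finset.card_powersetCard, Finset.card_univ,
    nsmul_eq_mul]
  ring

/-- The functional digraphs of the mappings of `V` into itself. -/
def mappingFamily : Finset (V → Option V) := univ.image fun (f : V → V) v => some (f v)

/-- Only the images of the roots of `g` are still free, and they are chosen independently. -/
theorem extCount_mappingFamily (g : V → Option V) :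
    extCount mappingFamily g ∅ [] = Fintype.card V ^ (rootsIn g univ).card := by
  classical
  have hinj : Function.Injective fun (f : V → V) v => some (f v) := fun f f' h =>
    funext fun v => Option.some.inj (congrFun h v)
  have h1 : mappingFamily.filter (fun F => Extends F g) =
      (Fintype.piFinset fun v => (g v).elim univ fun w => {w}).image
        fun (f : V → V) v => some (f v) := by
    ext F
    simp only [mappingFamily, Finset.mem_filter, Finset.mem_image, Finset.mem_univ, true_and,
      Fintype.mem_piFinset]
    constructor
    · rintro ⟨⟨f, rfl⟩, h⟩
      refine ⟨f, fun v => ?_, rfl⟩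
      cases hv : g v with
      | none => simp
      | some w =>
        have := h v w hv
        simpa using this
    · rintro ⟨f, h, rfl⟩
      refine ⟨⟨f, rfl⟩, fun v w hv => ?_⟩
      have := h v
      rw [hv] at this
      simpa using this
  rw [extCount_nil, h1, Finset.card_image_of_injective _ hinj, Fintype.card_piFinset]
  have h2 : ∀ v, ((g v).elim (univ : Finset V) fun w => {w}).card =
      if g v = none then Fintype.card V else 1 := by
    intro v
    cases g v <;> simp
  simp_rw [h2]
  rw [Finset.prod_ite, Finset.prod_const, Finset.prod_const_one, mul_one]
  rfl

open Classical in
/-- The rooted trees on `V`, given by their parent functions. -/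
noncomputable def treeFamily : Finset (V → Option V) :=
  univ.filter fun F => IsForest F ∧ (rootsIn F univ).card = 1

theorem mem_treeFamily {F : V → Option V} :
    F ∈ treeFamily ↔ IsForest F ∧ (rootsIn F univ).card = 1 := by
  simp [treeFamily]

theorem rootsIn_subset_of_extends {F g : V → Option V} (h : Extends F g) :
    rootsIn F univ ⊆ rootsIn g univ := by
  intro v hv
  rw [mem_rootsIn] at hv ⊢
  refine ⟨Finset.mem_univ _, ?_⟩
  cases hg : g v with
  | none => rfl
  | some w => simp [h v w hg] at hv

/-- With the extra street, every node of the tree of `v` has a street staying inside that tree, so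
an `F`-path from `x` never ends. -/
theorem not_extends_cycle {F g : V → Option V} (hF : IsForest F) {v x : V} (hx : Leads g x v) :
    ¬ Extends F (Function.update g v (some x)) := by
  intro h
  rw [extends_update_iff hx.target] at h
  have key : ∀ {u r : V}, Leads F u r → ¬ Leads g u v := by
    intro u r hu
    induction hu with
    | root h0 =>
      intro hg
      cases hg with
      | root _ => simp [h.2] at h0
      | step h1 _ => simp [h.1 _ _ h1] at h0
    | @step u w r h0 _ ih =>
      intro hg
      cases hg with
      | root _ =>
        rw [h.2] at h0
        cases h0
        exact ih hx
      | step h1 h2 =>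
        rw [h.1 _ _ h1] at h0
        cases h0
        exact ih h2
  obtain ⟨r, hr⟩ := hF x
  exact key hr hx

theorem rootsIn_card_pos [Nonempty V] {g : V → Option V} (hg : IsForest g) :
    0 < (rootsIn g univ).card := by
  obtain ⟨r, hr⟩ := hg (Classical.arbitrary V)
  exact Finset.card_pos.2 ⟨r, mem_rootsIn.2 ⟨Finset.mem_univ _, hr.target⟩⟩

/-- The number of rooted trees containing a given rooted forest. -/
theorem extCount_treeFamily (k : ℕ) {g : V → Option V} (hg : IsForest g)
    (hk : (rootsIn g univ).card = k + 1) :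
    extCount treeFamily g ∅ [] = Fintype.card V ^ k := by
  classical
  induction k generalizing g with
  | zero =>
    rw [extCount_nil, pow_zero, Finset.card_eq_one]
    refine ⟨g, ?_⟩
    ext F
    rw [Finset.mem_filter, mem_treeFamily, Finset.mem_singleton]
    constructor
    · rintro ⟨⟨_, h2⟩, h3⟩
      have h4 : rootsIn F univ = rootsIn g univ :=
        Finset.eq_of_subset_of_card_le (rootsIn_subset_of_extends h3) (by omega)
      funext v
      cases hv : g v with
      | none =>
        have : v ∈ rootsIn F univ := h4 ▸ mem_rootsIn.2 ⟨Finset.mem_univ _, hv⟩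
        exact (mem_rootsIn.1 this).2
      | some w => exact h3 v w hv
    · rintro rfl
      exact ⟨⟨hg, hk⟩, fun v w h => h⟩
  | succ k ih =>
    -- Double counting of pairs (tree extending `g`, root of `g` with a street in it). Of the k + 2
    -- roots of `g` exactly one remains the root of the tree, so each tree is counted k + 1 times.
    have h1 : ∑ v ∈ rootsIn g univ, ∑ x, extCount treeFamily
        (Function.update g v (some x)) ∅ [] = (k + 1) * extCount treeFamily g ∅ [] := by
      have h2 : ∀ v ∈ rootsIn g univ, ∑ x, extCount treeFamily
          (Function.update g v (some x)) ∅ [] =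
          ∑ F ∈ treeFamily.filter (fun F => Extends F g), if F v = none then 0 else 1 := by
        intro v hv
        have hgv := (mem_rootsIn.1 hv).2
        simp_rw [extCount_nil, extends_update_iff hgv, ← Finset.filter_filter,
          Finset.card_filter _ (Finset.filter _ treeFamily)]
        rw [Finset.sum_comm]
        refine Finset.sum_congr rfl fun F _ => ?_
        cases hFv : F v <;> simp
      rw [Finset.sum_congr rfl h2, Finset.sum_comm, extCount_nil, mul_comm,
        ← smul_eq_mul, ← Finset.sum_const]
      refine Finset.sum_congr rfl fun F hF => ?_
      rw [Finset.mem_filter, mem_treeFamily] at hF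
      have h3 := rootsIn_subset_of_extends hF.2
      have h4 : (rootsIn g univ).filter (fun v => F v = none) = rootsIn F univ := by
        ext v
        rw [Finset.mem_filter]
        constructor
        · rintro ⟨_, h⟩
          exact mem_rootsIn.2 ⟨Finset.mem_univ _, h⟩
        · intro h
          exact ⟨h3 h, (mem_rootsIn.1 h).2⟩
      have h5 := Finset.card_filter_add_card_filter_not (s := rootsIn g univ)
        (fun v => F v = none)
      rw [h4, hF.1.2, hk] at h5
      rw [Finset.sum_ite, Finset.sum_const_zero, zero_add, ← Finset.card_eq_sum_ones]
      omega
    -- The same pairs are counted by the target `x`: the root of the tree of `x` would give a cycle,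
    -- and each of the other k + 1 roots leaves a forest with one root fewer.
    have h6 : ∑ v ∈ rootsIn g univ, ∑ x, extCount treeFamily
        (Function.update g v (some x)) ∅ [] = (k + 1) * Fintype.card V ^ (k + 1) := by
      rw [Finset.sum_comm]
      have h7 : ∀ x ∈ (univ : Finset V), ∑ v ∈ rootsIn g univ, extCount treeFamily
          (Function.update g v (some x)) ∅ [] = (k + 1) * Fintype.card V ^ k := by
        intro x _
        obtain ⟨r, hr⟩ := hg x
        have hrr : r ∈ rootsIn g univ := mem_rootsIn.2 ⟨Finset.mem_univ _, hr.target⟩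
        have h8 : extCount treeFamily (Function.update g r (some x)) ∅ [] = 0 := by
          rw [extCount_nil, Finset.card_eq_zero, Finset.filter_eq_empty_iff]
          intro F hF
          exact not_extends_cycle (mem_treeFamily.1 hF).1 hr
        have h9 : ∀ v ∈ (rootsIn g univ).erase r, extCount treeFamily
            (Function.update g v (some x)) ∅ [] = Fintype.card V ^ k := by
          intro v hv
          obtain ⟨hvr, hv⟩ := Finset.mem_erase.1 hv
          refine ih (hg.update (mem_rootsIn.1 hv).2 hr hvr.symm) ?_
          rw [rootsIn_update, Finset.card_erase_of_mem hv]
          omega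
        rw [← Finset.add_sum_erase _ _ hrr, h8, Finset.sum_congr rfl h9, Finset.sum_const,
          Finset.card_erase_of_mem hrr, hk]
        simp
      rw [Finset.sum_congr rfl h7, Finset.sum_const, Finset.card_univ, smul_eq_mul]
      ring
    exact Nat.eq_of_mul_eq_mul_left (Nat.succ_pos k) (h1.symm.trans h6)

end Families

/-! ### Rooted trees as graphs correspond to parent functions in `treeFamily`. -/

section Trees

variable {n : ℕ}

/-- With `v = w` this also excludes loops. -/
theorem Leads.no_two_cycle {V : Type*} {F : V → Option V} {v w r : V} (h : Leads F v r)
    (hv : F v = some w) (hw : F w = some v) : False := by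
  induction h generalizing w with
  | root h => simp [h] at hv
  | step h1 _ ih =>
    rw [hv] at h1
    cases h1
    exact ih hw hv

theorem eq_of_mem_support_closed {V : Type*} {G : SimpleGraph V} {a b u : V} {p : G.Walk a b}
    (hp : p.IsPath) (h : a = b) (hu : u ∈ p.support) : u = a := by
  subst h
  rw [SimpleGraph.Walk.isPath_iff_nil, ← SimpleGraph.Walk.eq_nil_iff_nil] at hp
  simpa [hp] using hu

theorem RootedTree.parent_of_path (T : RootedTree n) {u v : Fin n} (h : T.graph.Adj u v)
    (p : T.graph.Walk v T.root) (hp : (SimpleGraph.Walk.cons h p).IsPath) :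
    T.parent u = some v := by
  have h1 : T.pathToRoot u = SimpleGraph.Walk.cons h p :=
    (T.isTree.existsUnique_path u T.root).unique
      (T.isTree.existsUnique_path u T.root).choose_spec.1 hp
  have h2 : u ≠ T.root := by
    rintro rfl
    exact absurd p.end_mem_support ((SimpleGraph.Walk.cons_isPath_iff _ _).1 hp).2
  rw [RootedTree.parent, if_neg h2, h1]
  simp

theorem RootedTree.pathToRoot_isPath (T : RootedTree n) (v : Fin n) : (T.pathToRoot v).IsPath :=
  (T.isTree.existsUnique_path v T.root).choose_spec.1

theorem RootedTree.parent_eq_none_iff (T : RootedTree n) (v : Fin n) :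
    T.parent v = none ↔ v = T.root := by
  by_cases h : v = T.root <;> simp [RootedTree.parent, h]

theorem RootedTree.leads_root (T : RootedTree n) (v : Fin n) : Leads T.parent v T.root := by
  have key : ∀ {u r : Fin n} (p : T.graph.Walk u r), r = T.root → p.IsPath →
      Leads T.parent u r := by
    intro u r p
    induction p with
    | nil =>
      intro h _
      exact .root ((T.parent_eq_none_iff _).2 h)
    | cons h p ih =>
      rintro rfl hp
      exact .step (T.parent_of_path h p hp) (ih rfl hp.of_cons)
  exact key (T.pathToRoot v) rfl (T.pathToRoot_isPath v)

theorem RootedTree.parent_mem (T : RootedTree n) : T.parent ∈ treeFamily := by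
  rw [mem_treeFamily, Finset.card_eq_one]
  refine ⟨fun v => ⟨_, T.leads_root v⟩, T.root, ?_⟩
  ext v
  simp [mem_rootsIn, T.parent_eq_none_iff]

/-- If `u` lies on the path from `v` to the root, acyclicity makes it the second node there;
otherwise prepending `u` gives the path from `u`. -/
theorem RootedTree.adj_iff (T : RootedTree n) (u v : Fin n) :
    T.graph.Adj u v ↔ T.parent u = some v ∨ T.parent v = some u := by
  have h1 : ∀ {u v : Fin n}, T.parent u = some v → T.graph.Adj u v := by
    intro u v h
    by_cases hu : u = T.root
    · simp [RootedTree.parent, hu] at h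
    · rw [RootedTree.parent, if_neg hu] at h
      cases h
      exact SimpleGraph.Walk.adj_snd (SimpleGraph.Walk.not_nil_of_ne hu)
  constructor
  · intro h
    by_cases hu : u ∈ (T.pathToRoot v).support
    · right
      have h2 := T.isTree.isAcyclic.eq_snd_of_adj_start (T.pathToRoot_isPath v) h.symm hu
      have hv : v ≠ T.root := by
        intro hv
        exact h.ne (eq_of_mem_support_closed (T.pathToRoot_isPath v) hv hu)
      rw [RootedTree.parent, if_neg hv, h2]
    · left
      exact T.parent_of_path h _ ((SimpleGraph.Walk.cons_isPath_iff _ _).2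
        ⟨T.pathToRoot_isPath v, hu⟩)
  · rintro (h | h)
    exacts [h1 h, (h1 h).symm]

theorem RootedTree.parent_injective :
    Function.Injective (RootedTree.parent : RootedTree n → Fin n → Option (Fin n)) := by
  intro T T' h
  refine RootedTree.ext ?_ ?_
  · ext u v
    rw [T.adj_iff, T'.adj_iff, h]
  · rw [← T'.parent_eq_none_iff, ← h, T.parent_eq_none_iff]

theorem exists_parent_eq {F : Fin n → Option (Fin n)} (hF : F ∈ treeFamily) :
    ∃ T : RootedTree n, T.parent = F := by
  obtain ⟨hf, hr⟩ := mem_treeFamily.1 hF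
  obtain ⟨r, hr⟩ := Finset.card_eq_one.1 hr
  have hroot : ∀ v, F v = none ↔ v = r := by
    intro v
    have := Finset.ext_iff.1 hr v
    simpa [mem_rootsIn] using this
  have hlead : ∀ v, Leads F v r := by
    intro v
    obtain ⟨t, ht⟩ := hf v
    rwa [(hroot t).1 ht.target] at ht
  let G : SimpleGraph (Fin n) :=
    { Adj := fun u v => F u = some v ∨ F v = some u
      symm := ⟨fun u v h => h.symm⟩
      loopless := ⟨fun v h => (hlead v).no_two_cycle (h.elim id id) (h.elim id id)⟩ }
  have hreach : ∀ v, G.Reachable v r := by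
    intro v
    have := hlead v
    induction this with
    | root _ => exact SimpleGraph.Reachable.refl _
    | @step v w t h1 h2 ih =>
      exact (SimpleGraph.Adj.reachable (show G.Adj v w from Or.inl h1)).trans (ih hr hroot hlead)
  have hconn : G.Connected :=
    { preconnected := fun u v => (hreach u).trans (hreach v).symm
      nonempty := ⟨r⟩ }
  have htree : G.IsTree := by
    classical
    refine (SimpleGraph.isTree_iff_connected_and_card).2 ⟨hconn, le_antisymm ?_ ?_⟩
    -- Each edge is the street of a non-root node, so there are at most n - 1 edges, and a connected
    -- graph with so few is a tree. The default of `getD` is never used, since `F` is defined off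
    -- `r`.
    · have h1 : G.edgeSet ⊆ ((univ.erase r).image fun v => s(v, (F v).getD v) : Finset _) := by
        intro e
        induction e with
        | _ u v =>
          rw [SimpleGraph.mem_edgeSet, Finset.mem_coe, Finset.mem_image]
          rintro (h | h)
          · refine ⟨u, Finset.mem_erase.2 ⟨fun hu => ?_, Finset.mem_univ _⟩, by simp [h]⟩
            simp [(hroot u).2 hu] at h
          · refine ⟨v, Finset.mem_erase.2 ⟨fun hv => ?_, Finset.mem_univ _⟩, ?_⟩
            · simp [(hroot v).2 hv] at h
            · simp [h, Sym2.eq_swap]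
      have h2 := Set.ncard_le_ncard h1 (Finset.finite_toSet _)
      rw [Set.ncard_coe_finset] at h2
      have h3 := h2.trans Finset.card_image_le
      rw [Finset.card_erase_of_mem (Finset.mem_univ _), Finset.card_univ, Fintype.card_fin] at h3
      have h4 : 0 < n := r.pos
      rw [Nat.card_coe_set_eq, Nat.card_eq_fintype_card, Fintype.card_fin]
      omega
    · exact hconn.card_vert_le_card_edgeSet_add_one
  refine ⟨⟨G, htree, r⟩, funext fun v => ?_⟩
  have hnone : ∀ u, RootedTree.parent ⟨G, htree, r⟩ u = none ↔ F u = none := fun u =>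
    (RootedTree.parent_eq_none_iff _ u).trans (hroot u).symm
  have hadj := RootedTree.adj_iff ⟨G, htree, r⟩
  -- Induction from the root outwards: if the edge between `u` and `w` were directed from `w` to `u`
  -- in the tree, then also `F w = some u`, a two-cycle of `F`.
  have key : ∀ {u t}, Leads F u t → RootedTree.parent ⟨G, htree, r⟩ u = F u := by
    intro u t hu
    induction hu with
    | root h => rw [h, hnone, h]
    | @step u w t h1 _ ih =>
      rcases (hadj u w).1 (Or.inl h1) with h | h
      · rw [h, h1]
      · exact ((hlead u).no_two_cycle h1 (ih ▸ h)).elim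
  exact key (hlead v)

theorem mem_treeFamily_iff_exists {F : Fin n → Option (Fin n)} :
    F ∈ treeFamily ↔ ∃ T : RootedTree n, T.parent = F :=
  ⟨exists_parent_eq, fun ⟨T, h⟩ => h ▸ T.parent_mem⟩

end Trees

/-! ### Assembling the two counts. -/

section Main

theorem numMapping_eq {n m : ℕ} :
    (numMapping n m : ℚ) = m.factorial *
      (n.choose m * (m.factorial * PowerSeries.coeff m (forestSeries n))) *
        (n : ℚ) ^ (n - m) := by
  have h := card_parking_eq (V := Fin n) (ι := Fin n → Fin n) (Fam := mappingFamily)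
    (fun f v => some (f v)) (fun f f' h => funext fun v => Option.some.inj (congrFun h v))
    (fun F => by simp [mappingFamily]) n 1
    (fun g _ => by rw [extCount_mappingFamily, Fintype.card_fin]; simp) m
    (fun u => PowerSeries.coeff u (forestSeries n)) (forestSeries_zero n) (forestSeries_rec n)
  rw [Fintype.card_fin, mul_one] at h
  exact h

theorem numTree_eq {n m : ℕ} (hn : 1 ≤ n) :
    (numTree n m : ℚ) = (numMapping n m : ℚ) / n := by
  have : Nonempty (Fin n) := ⟨⟨0, hn⟩⟩
  have hn0 : (n : ℚ) ≠ 0 := by positivity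
  -- The mapping count with `b = 1` replaced by `b = 1 / n`: a forest with k + 1 roots has n^k =
  -- n^(k+1) / n extensions to a tree.
  have h := card_parking_eq (V := Fin n) (ι := RootedTree n) (Fam := treeFamily)
    RootedTree.parent RootedTree.parent_injective (fun F => mem_treeFamily_iff_exists) n (1 / n)
    (fun g hg => by
      obtain ⟨k, hk⟩ := Nat.exists_eq_succ_of_ne_zero (rootsIn_card_pos hg).ne'
      rw [extCount_treeFamily k hg hk, hk, Fintype.card_fin, pow_succ]
      push_cast
      field_simp) m
    (fun u => PowerSeries.coeff u (forestSeries n)) (forestSeries_zero n) (forestSeries_rec n)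
  rw [Fintype.card_fin] at h
  rw [numMapping_eq, mul_div_assoc, div_eq_mul_one_div ((n : ℚ) ^ (n - m))]
  exact h

end Main

end Parking

theorem mainTheorem1 (n m : ℕ) (hn : 1 ≤ n) (hm : m ≤ n) :
    (Parking.numMapping n m : ℚ) =
        ((n - 1).factorial : ℚ) * (m.factorial : ℚ) * (n : ℚ) ^ (n - m) /
            ((n - m).factorial : ℚ) *
          ∑ j ∈ Finset.range (m + 1),
            ((Ring.choose (2 * (m : ℤ) - (n : ℤ) - (j : ℤ)) (m - j) : ℤ) : ℚ) *
              ((2 * (n : ℚ)) ^ j * ((n : ℚ) - (j : ℚ)) / (j.factorial : ℚ)) ∧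
      (Parking.numTree n m : ℚ) =
        ((n - 1).factorial : ℚ) * (m.factorial : ℚ) * (n : ℚ) ^ ((n : ℤ) - (m : ℤ) - 1) /
            ((n - m).factorial : ℚ) *
          ∑ j ∈ Finset.range (m + 1),
            ((Ring.choose (2 * (m : ℤ) - (n : ℤ) - (j : ℤ)) (m - j) : ℤ) : ℚ) *
              ((2 * (n : ℚ)) ^ j * ((n : ℚ) - (j : ℚ)) / (j.factorial : ℚ)) ∧
      (Parking.numTree n m : ℚ) = (Parking.numMapping n m : ℚ) / (n : ℚ) := by
  have hn0 : (n : ℚ) ≠ 0 := by positivity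
  have hM : (Parking.numMapping n m : ℚ) =
        ((n - 1).factorial : ℚ) * (m.factorial : ℚ) * (n : ℚ) ^ (n - m) /
            ((n - m).factorial : ℚ) *
          ∑ j ∈ Finset.range (m + 1),
            ((Ring.choose (2 * (m : ℤ) - (n : ℤ) - (j : ℤ)) (m - j) : ℤ) : ℚ) *
              ((2 * (n : ℚ)) ^ j * ((n : ℚ) - (j : ℚ)) / (j.factorial : ℚ)) := by
    rw [← Parking.coeff_forestSeries, Parking.numMapping_eq]
    have h1 : ((n.choose m : ℕ) : ℚ) * m.factorial * (n - m).factorial = n.factorial := by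
      exact_mod_cast Nat.choose_mul_factorial_mul_factorial hm
    have h2 : (n : ℚ) * (n - 1).factorial = n.factorial := by
      exact_mod_cast Nat.mul_factorial_pred (by omega)
    have h3 : ((n - m).factorial : ℚ) ≠ 0 := by positivity
    rw [div_mul_eq_mul_div, eq_div_iff h3]
    linear_combination (m.factorial * PowerSeries.coeff m (Parking.forestSeries n) *
      (n : ℚ) ^ (n - m)) * (h1 - h2)
  have hT := Parking.numTree_eq (m := m) hn
  refine ⟨hM, ?_, hT⟩
  -- For m = n the exponent is -1, which is why the tree formula uses an integer power.
  rw [hT, hM, show (n : ℤ) - (m : ℤ) - 1 = ((n - m : ℕ) : ℤ) - 1 by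
    push_cast [Nat.cast_sub hm]; ring, zpow_sub_one₀ hn0, zpow_natCast]
  ring
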